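/- Let $\Gamma$ be a finite bipartite distance-regular graph with vertex set $X$, path-length distance $\partial$, diameter $D\ge 4$, valency $k\ge 3$ and intersection numbers $p^h_{ij}=|\{z:\partial(y,z)=i,\ \partial(z,w)=j\}|$ for $\partial(y,w)=h$; write $c_i=p^i_{1,i-1}$ $(1\le i\le D)$, $c_0=0$, $b_i=p^i_{1,i+1}$ $(0\le i\le D-1)$, $b_D=0$. Let $A_i\in\mathrm{Mat}_X(\mathbb C)$ be the $i$-th distance matrix, $A=A_1$ the adjacency matrix, and $\theta_0>\theta_1>\cdots>\theta_D$ the distinct eigenvalues of $A$. Let $f_0,\dots,f_D\in\mathbb R[\lambda]$ be given by $f_{-1}=0$, $f_0=1$, $\lambda f_i=b_{i-1}f_{i-1}+c_{i+1}f_{i+1}$ $(0\le i\le D-1)$, and let $p_i=f_i+f_{i-2}+f_{i-4}+\cdots$, the sum ending in $f_0$ or $f_1$ according to the parity of $i$ $(0\le i\le D)$. Fix $x\in X$. For $0\le i\le D$ let $E_i^*$ be the diagonal matrix with $(y,y)$-entry $1$ if $\partial(x,y)=i$ and $0$ otherwise, and let $T$ be the subalgebra of $\mathrm{Mat}_X(\mathbb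 C)$ generated by $A,E_0^*,\dots,E_D^*$. A $T$-module is a subspace $W\subseteq\mathbb C^X$ with $TW\subseteq W$; it is irreducible if it is nonzero and contains no $T$-modules besides $0$ and $W$. An irreducible $T$-module $W$ is thin if $\dim E_i^*W\le 1$ for $0\le i\le D$, and its endpoint is $\min\{i: E_i^*W\ne 0\}$. If $W$ is thin with endpoint $2$, its local eigenvalue is the scalar by which $E_2^*A_2E_2^*$ acts on $E_2^*W$. Let $d=\lfloor D/2\rfloor$. Choose $n\in\{1,d\}$ if $D$ is odd, and let $n=1$ if $D$ is even. Let $W$ be a thin irreducible $T$-module with endpoint $2$ and local eigenvalue $$\tilde\theta_n=-1-\frac{b_2b_3}{\theta_n^2-b_2},$$ and let $v$ be a nonzero vector in $E_2^*W$. Then the vectors $E_{i+2}^*A_iv$ $(0\le i\le D-4)$ form a basis of $W$, and with respect to this basis (in this order, the columns being the coordinates of the images of the basis vectors) the matrix representing $A$ is the $(D-3)\times(D-3)$ tridiagonal matrix $$\begin{pmatrix}0&\omega_1&&&\mathbf 0\\ c_1&0&\omega_2&&\\ &c_2&\ddots&\ddots&\\ &&\ddots&\ddots&\omega_{D-4}\\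 \mathbf 0&&&c_{D-4}&0\end{pmatrix},\qquad \omega_i=\frac{b_{i+1}c_{i+2}}{c_i}\,\frac{p_{i-1}(\theta_n)\,p_{i+2}(\theta_n)}{p_i(\theta_n)\,p_{i+1}(\theta_n)}\quad(1\le i\le D-4),$$ where the denominators $c_i$, $p_i(\theta_n)$, $p_{i+1}(\theta_n)$ in $\omega_i$ are nonzero for $1\le i\le D-4$. -/

import Mathlib

open scoped Matrix Polynomial

namespace DRG

variable {X : Type*} [Fintype X]

section Combinatorics

/-- The number of vertices at distance `i` from `y` and at distance `j` from `z`. -/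
noncomputable def sphereCount (Γ : SimpleGraph X) (y z : X) (i j : ℕ) : ℕ :=
  (Finset.univ.filter fun w : X => Γ.dist y w = i ∧ Γ.dist w z = j).card

/-- A connected graph of diameter `D` is distance-regular if, for all `0 ≤ h, i, j ≤ D`, the number
of vertices at distance `i` from `y` and `j` from `z` is the same for all pairs `y, z` at
distance `h`. -/
structure IsDistanceRegular (Γ : SimpleGraph X) : Prop where
  connected : Γ.Connected
  regular : ∀ h i j : ℕ, h ≤ Γ.diam → i ≤ Γ.diam → j ≤ Γ.diam →
    ∃ m : ℕ, ∀ y z : X, Γ.dist y z = h → sphereCount Γ y z i j = m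

open Classical in
/-- The intersection number `p^h_{ij}`, evaluated at an arbitrary pair of vertices at distance `h`
(and `0` if there is no such pair). -/
noncomputable def intersectionNumber (Γ : SimpleGraph X) (h i j : ℕ) : ℕ :=
  if H : ∃ q : X × X, Γ.dist q.1 q.2 = h then sphereCount Γ H.choose.1 H.choose.2 i j else 0

/-- In a distance-regular graph the intersection number does not depend on the chosen pair. -/
theorem IsDistanceRegular.sphereCount_eq {Γ : SimpleGraph X} (hΓ : IsDistanceRegular Γ)
    {h i j : ℕ} (hh : h ≤ Γ.diam) (hi : i ≤ Γ.diam) (hj : j ≤ Γ.diam) {y z : X}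
    (hyz : Γ.dist y z = h) : sphereCount Γ y z i j = intersectionNumber Γ h i j := by
  obtain ⟨m, hm⟩ := hΓ.regular h i j hh hi hj
  have H : ∃ q : X × X, Γ.dist q.1 q.2 = h := ⟨(y, z), hyz⟩
  rw [intersectionNumber, dif_pos H, hm y z hyz, hm _ _ H.choose_spec]

/-- `c_i = p^i_{1,i-1}` for `i ≥ 1`, and `c_0 = 0`. -/
noncomputable def c (Γ : SimpleGraph X) : ℕ → ℕ
  | 0 => 0
  | i + 1 => intersectionNumber Γ (i + 1) 1 i

/-- `b_i = p^i_{1,i+1}`; this gives `b_D = 0`, and `b_0` is the valency. -/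
noncomputable def b (Γ : SimpleGraph X) (i : ℕ) : ℕ :=
  intersectionNumber Γ i 1 (i + 1)

/-- The polynomials `f_i` with `f_0 = 1`, `f_{-1} = 0` and
`λ f_i = b_{i-1} f_{i-1} + c_{i+1} f_{i+1}`. -/
noncomputable def f (Γ : SimpleGraph X) : ℕ → ℝ[X]
  | 0 => 1
  | 1 => Polynomial.C ((c Γ 1 : ℝ)⁻¹) * Polynomial.X
  | i + 2 => Polynomial.C ((c Γ (i + 2) : ℝ)⁻¹) *
      (Polynomial.X * f Γ (i + 1) - Polynomial.C (b Γ i : ℝ) * f Γ i)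

/-- The polynomial `p_i = f_i + f_{i-2} + f_{i-4} + ⋯`, ending in `f_0` or `f_1`. -/
noncomputable def p (Γ : SimpleGraph X) (i : ℕ) : ℝ[X] :=
  ∑ h ∈ (Finset.range (i + 1)).filter (fun h => h % 2 = i % 2), f Γ h

/-- `ω_i = (b_{i+1} c_{i+2} / c_i) · p_{i-1}(t) p_{i+2}(t) / (p_i(t) p_{i+1}(t))`, for `i ≥ 1`. -/
noncomputable def omega (Γ : SimpleGraph X) (t : ℝ) (i : ℕ) : ℝ :=
  ((b Γ (i + 1) : ℝ) * (c Γ (i + 2) : ℝ) / (c Γ i : ℝ)) *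
    (((p Γ (i - 1)).eval t * (p Γ (i + 2)).eval t) / ((p Γ i).eval t * (p Γ (i + 1)).eval t))

/-- `z̃ = -1 - b_2 b_3 / (z² - b_2)`, for real `z` with `z² ≠ b_2`. -/
noncomputable def tilde (Γ : SimpleGraph X) (z : ℝ) : ℝ :=
  -1 - (b Γ 2 : ℝ) * (b Γ 3 : ℝ) / (z ^ 2 - (b Γ 2 : ℝ))

/-- The `i`-th distance matrix, in `Mat_X(ℂ)`. -/
noncomputable def distanceMatrix (Γ : SimpleGraph X) (i : ℕ) : Matrix X X ℂ :=
  Matrix.of fun y z => if Γ.dist y z = i then 1 else 0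

/-- The adjacency matrix `A = A_1`. -/
noncomputable abbrev adjacency (Γ : SimpleGraph X) : Matrix X X ℂ := distanceMatrix Γ 1

end Combinatorics

section Algebra

variable [DecidableEq X]

/-- `θ_i`, where `θ_0 > θ_1 > ⋯` are the distinct eigenvalues of `A` (all of them are real). -/
noncomputable def eigenvalue (Γ : SimpleGraph X) (i : ℕ) : ℝ :=
  ((Matrix.finite_real_spectrum (A := adjacency Γ)).toFinset.sort (fun s t => s ≥ t)).getD i 0

/-- The `i`-th dual idempotent `E*_i` with respect to `x`. -/
noncomputable def dualIdempotent (Γ : SimpleGraph X) (x : X) (i : ℕ) : Matrix X X ℂ :=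
  Matrix.diagonal fun y => if Γ.dist x y = i then 1 else 0

/-- The subconstituent algebra `T = T(x)`, generated by `A` and the dual idempotents. -/
noncomputable def subconstituentAlgebra (Γ : SimpleGraph X) (x : X) :
    Subalgebra ℂ (Matrix X X ℂ) :=
  Algebra.adjoin ℂ (insert (adjacency Γ) (Set.range (dualIdempotent Γ x)))

/-- A `T`-module: a subspace `W` of the standard module `V = ℂ^X` with `B W ⊆ W` for `B ∈ T`. -/
def IsTModule (Γ : SimpleGraph X) (x : X) (W : Submodule ℂ (X → ℂ)) : Prop :=
  ∀ B ∈ subconstituentAlgebra Γ x, ∀ w ∈ W, B *ᵥ w ∈ W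

/-- An irreducible `T`-module: nonzero, and containing no `T`-modules besides `0` and itself. -/
structure IsIrreducibleTModule (Γ : SimpleGraph X) (x : X) (W : Submodule ℂ (X → ℂ)) : Prop where
  isTModule : IsTModule Γ x W
  ne_bot : W ≠ ⊥
  eq_bot_or_eq : ∀ W' : Submodule ℂ (X → ℂ), W' ≤ W → IsTModule Γ x W' → W' = ⊥ ∨ W' = W

/-- The subspace `E*_i W`. -/
noncomputable def dualComponent (Γ : SimpleGraph X) (x : X) (W : Submodule ℂ (X → ℂ)) (i : ℕ) :
    Submodule ℂ (X → ℂ) :=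
  W.map (dualIdempotent Γ x i).mulVecLin

/-- `W` is thin: `dim E*_i W ≤ 1` for `0 ≤ i ≤ D`. -/
def IsThin (Γ : SimpleGraph X) (x : X) (W : Submodule ℂ (X → ℂ)) : Prop :=
  ∀ i ≤ Γ.diam, Module.finrank ℂ (dualComponent Γ x W i) ≤ 1

/-- The endpoint of `W`: the least `i` with `0 ≤ i ≤ D` and `E*_i W ≠ 0`. -/
noncomputable def endpoint (Γ : SimpleGraph X) (x : X) (W : Submodule ℂ (X → ℂ)) : ℕ :=
  sInf {i | i ≤ Γ.diam ∧ dualComponent Γ x W i ≠ ⊥}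

/-- `E*_2 W` is nonzero and `E*_2 A_2 E*_2` acts on it as the scalar `η`. -/
def HasLocalEigenvalue (Γ : SimpleGraph X) (x : X) (W : Submodule ℂ (X → ℂ)) (η : ℝ) : Prop :=
  dualComponent Γ x W 2 ≠ ⊥ ∧
    ∀ u ∈ dualComponent Γ x W 2,
      (dualIdempotent Γ x 2 * distanceMatrix Γ 2 * dualIdempotent Γ x 2) *ᵥ u = (η : ℂ) • u

/-- The action of `A` on a `T`-module `W`. -/
noncomputable def adjacencyOn (Γ : SimpleGraph X) (x : X) (W : Submodule ℂ (X → ℂ))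
    (hW : IsTModule Γ x W) : W →ₗ[ℂ] W :=
  (adjacency Γ).mulVecLin.restrict fun w hw =>
    hW _ (Algebra.subset_adjoin (Set.mem_insert _ _)) w hw

/-- The `(D-3) × (D-3)` tridiagonal matrix with zero diagonal, subdiagonal `c_1, …, c_{D-4}` and
superdiagonal `ω_1, …, ω_{D-4}`. Rows and columns are indexed by `0, …, D-4`. -/
noncomputable def tridiagonal (Γ : SimpleGraph X) (t : ℝ) :
    Matrix (Fin (Γ.diam - 3)) (Fin (Γ.diam - 3)) ℂ :=
  Matrix.of fun r s =>
    if (r : ℕ) = (s : ℕ) + 1 then (c Γ r : ℂ)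
    else if (s : ℕ) = (r : ℕ) + 1 then ((omega Γ t s : ℝ) : ℂ)
    else 0

end Algebra

end DRG

/-! Put u_r = E*_{r+2} A_r v. Endpoint 2 gives E*_0 W = E*_1 W = 0, so the entries of v sum to zero
and E*_1 A v = 0. By bipartiteness only A_r, A_{r+2} and A_{r+4} link the support of v to the sphere
of radius r+2, and the three vectors E*_{r+2} A_j v so obtained sum to zero. Cutting A A_{j+1} = b_j
A_j + c_{j+2} A_{j+2} with dual idempotents (`adjacency_localVector_add`) gives the raising rule
E*_{r+3} A u_r = c_{r+1} u_{r+1}. If moreover E*_{j+2} A_{j+4} v = -α_j u_j for all j ≤ r, with α_j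
= `localRatio`, it gives the lowering rule E*_{r+2} A u_{r+1} = ω_{r+1} u_r.

The local eigenvalue η fixes α_0 = 1 + η. By thinness E*_{r+3} A_{r+5} v is a multiple of u_{r+1};
lowering it in two ways gives α_{r+1} ω_{r+1} = b_{r+4} α_r ≠ 0. This determines α_{r+1} and forces
p_{r+3}(θ_n) ≠ 0, a factor of ω_{r+1}: the denominators are nonzero because W exists, with no
interlacing argument (`localVector_ne_zero_and`). The chain stops since p_{D-1}(θ_n) = 0 makes
ω_{D-3} = 0, whence u_{D-3} = 0 because raising and lowering are adjoint. The remaining span is a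
T-module, so it is W.

The spectral input is 0 < θ_n < k and θ_n² ≠ b_2. The last holds because the sum of (k² - θ²)(θ² -
b_2) over the spectrum, with multiplicity, is zero, while θ_n² = b_2 would give all terms one sign,
θ_n being extremal; at most four eigenvalues would then remain. -/

namespace DRG

/-! ### Geodesics, and parity of distances in a bipartite graph. -/

section Distances

variable {X : Type*} {Γ : SimpleGraph X}

theorem IsDistanceRegular.dist_le_diam [Fintype X] (hΓ : IsDistanceRegular Γ) (y z : X) :
    Γ.dist y z ≤ Γ.diam := by
  have : Nonempty X := ⟨y⟩
  exact SimpleGraph.dist_le_diam (SimpleGraph.connected_iff_ediam_ne_top.1 hΓ.connected)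

/-- In a connected graph every distance up to `dist y z` from `y` occurs on a geodesic to `z`. -/
theorem exists_dist_eq_add (hc : Γ.Connected) {y z : X} {i j : ℕ} (h : Γ.dist y z = i + j) :
    ∃ w, Γ.dist y w = i ∧ Γ.dist w z = j := by
  obtain ⟨q, hq⟩ := hc.exists_walk_length_eq_dist y z
  refine ⟨q.getVert i, ?_⟩
  have h1 : Γ.dist y (q.getVert i) ≤ i :=
    (SimpleGraph.dist_le (q.take i)).trans (by rw [SimpleGraph.Walk.take_length]; omega)
  have h2 : Γ.dist (q.getVert i) z ≤ j :=
    (SimpleGraph.dist_le (q.drop i)).trans (by rw [SimpleGraph.Walk.drop_length]; omega)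
  have h3 := hc.dist_triangle (u := y) (v := q.getVert i) (w := z)
  omega

/-- All distances up to the diameter occur, along a single geodesic. -/
theorem exists_geodesic_triple (hc : Γ.Connected) {h i j : ℕ} (hij : i + j = h)
    (hh : h ≤ Γ.diam) : ∃ y w z : X, Γ.dist y z = h ∧ Γ.dist y w = i ∧ Γ.dist w z = j := by
  have := hc.nonempty
  obtain ⟨y, z, hyz⟩ := Γ.exists_dist_eq_diam
  obtain ⟨z', h1, -⟩ := exists_dist_eq_add hc (hyz.trans (Nat.add_sub_of_le hh).symm)
  obtain ⟨w, h2, h3⟩ := exists_dist_eq_add hc (h1.trans hij.symm)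
  exact ⟨y, w, z', h1, h2, h3⟩

/-- In a connected bipartite graph distances add up modulo two. -/
theorem even_dist_add_dist_add_dist (hc : Γ.Connected) (hbip : Γ.IsBipartite) (y w z : X) :
    Even (Γ.dist y w + Γ.dist w z + Γ.dist y z) := by
  obtain ⟨C⟩ := hbip
  let C' : Γ.Coloring Bool := SimpleGraph.recolorOfEquiv Γ finTwoEquiv C
  have key : ∀ a b : X, Even (Γ.dist a b) ↔ (C' a ↔ C' b) := fun a b => by
    obtain ⟨q, hq⟩ := hc.exists_walk_length_eq_dist a b
    rw [← hq]
    exact C'.even_length_iff_congr q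
  rw [Nat.even_add, Nat.even_add, key, key, key]
  tauto

end Distances

/-! ### Positivity and sum rules for the intersection numbers. -/

section IntersectionNumbers

variable {X : Type*} [Fintype X] {Γ : SimpleGraph X}

theorem sphereCount_pos {y z : X} {i j : ℕ} (w : X) (h1 : Γ.dist y w = i) (h2 : Γ.dist w z = j) :
    0 < sphereCount Γ y z i j :=
  Finset.card_pos.2 ⟨w, by simp [h1, h2]⟩

theorem IsDistanceRegular.b_pos (hΓ : IsDistanceRegular Γ) {i : ℕ} (hi : i < Γ.diam) :
    0 < b Γ i := by
  obtain ⟨w, y, z, h1, h2, h3⟩ :=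
    exists_geodesic_triple hΓ.connected (Nat.add_comm 1 i) (Nat.succ_le_of_lt hi)
  rw [b, ← hΓ.sphereCount_eq hi.le (by omega) hi h3]
  exact sphereCount_pos w (SimpleGraph.dist_comm.trans h2) h1

theorem IsDistanceRegular.c_pos (hΓ : IsDistanceRegular Γ) {i : ℕ} (hi : i + 1 ≤ Γ.diam) :
    0 < c Γ (i + 1) := by
  obtain ⟨y, w, z, h1, h2, h3⟩ :=
    exists_geodesic_triple hΓ.connected (Nat.add_comm 1 i) hi
  rw [c, ← hΓ.sphereCount_eq hi (by omega) (by omega) h1]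
  exact sphereCount_pos w h2 h3

theorem IsDistanceRegular.b_eq_zero (hΓ : IsDistanceRegular Γ) {i : ℕ} (hi : Γ.diam ≤ i) :
    b Γ i = 0 := by
  rw [b, intersectionNumber]
  split_ifs with H
  · refine Finset.card_eq_zero.2 (Finset.filter_eq_empty_iff.2 fun w _ hw => ?_)
    have := hΓ.dist_le_diam w H.choose.2
    omega
  · rfl

/-- Regularity covers indices up to D only, so for i = D the index i + 1 needs its own argument:
both sides count nothing. -/
theorem IsDistanceRegular.sphereCount_one_succ (hΓ : IsDistanceRegular Γ) {y z : X} {i : ℕ}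
    (hyz : Γ.dist y z = i) : sphereCount Γ y z 1 (i + 1) = b Γ i := by
  have h := hΓ.dist_le_diam y z
  rcases Nat.lt_or_ge i Γ.diam with hi | hi
  · exact hΓ.sphereCount_eq hi.le (by omega) hi hyz
  · rw [hΓ.b_eq_zero hi]
    refine Finset.card_eq_zero.2 (Finset.filter_eq_empty_iff.2 fun w _ hw => ?_)
    have := hΓ.dist_le_diam w z
    omega

theorem IsDistanceRegular.sphereCount_one_pred (hΓ : IsDistanceRegular Γ) {y z : X} {i : ℕ}
    (hyz : Γ.dist y z = i + 1) : sphereCount Γ y z 1 i = c Γ (i + 1) := by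
  have h := hΓ.dist_le_diam y z
  exact hΓ.sphereCount_eq (by omega) (by omega) (by omega) hyz

/-- A neighbor of y changes the distance to z by at most one, and parity excludes no change. -/
theorem sphereCount_one_eq_zero (hc : Γ.Connected) (hbip : Γ.IsBipartite) {y z : X} {i : ℕ}
    (h1 : Γ.dist y z ≠ i + 1) (h2 : i ≠ Γ.dist y z + 1) : sphereCount Γ y z 1 i = 0 := by
  refine Finset.card_eq_zero.2 (Finset.filter_eq_empty_iff.2 fun w _ hw => ?_)
  have h3 := hc.dist_triangle (u := y) (v := w) (w := z)
  have h4 := hc.dist_triangle (u := w) (v := y) (w := z)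
  have h5 := even_dist_add_dist_add_dist hc hbip y w z
  rw [Γ.dist_comm (u := w) (v := y)] at h4
  rw [Nat.even_iff] at h5
  omega

theorem IsDistanceRegular.c_one (hΓ : IsDistanceRegular Γ) (hD : 1 ≤ Γ.diam) : c Γ 1 = 1 := by
  obtain ⟨y, w, z, h1, h2, h3⟩ := exists_geodesic_triple hΓ.connected (Nat.add_zero 1) hD
  rw [← hΓ.sphereCount_one_pred h1, sphereCount, Finset.card_eq_one]
  refine ⟨z, ?_⟩
  ext u
  simp only [Finset.mem_filter, Finset.mem_univ, true_and, Finset.mem_singleton,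
    hΓ.connected.dist_eq_zero_iff]
  exact ⟨fun h => h.2, fun h => ⟨h ▸ h1, h⟩⟩

theorem IsDistanceRegular.card_neighbors (hΓ : IsDistanceRegular Γ) (y : X) :
    (Finset.univ.filter fun w => Γ.dist y w = 1).card = b Γ 0 := by
  rw [← hΓ.sphereCount_one_succ (Γ.dist_self (v := y)), sphereCount]
  congr 1
  ext w
  simp [Γ.dist_comm (u := w) (v := y)]

/-- Bipartiteness leaves no neighbor at unchanged distance, so the neighbors split into the nearer
and the farther ones. -/
theorem IsDistanceRegular.c_add_b (hΓ : IsDistanceRegular Γ) (hbip : Γ.IsBipartite) {i : ℕ}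
    (hi : i ≤ Γ.diam) : c Γ i + b Γ i = b Γ 0 := by
  classical
  rcases i with _ | i
  · simp [c]
  obtain ⟨y, -, z, h1, -, -⟩ := exists_geodesic_triple hΓ.connected (Nat.add_zero (i + 1)) hi
  rw [← hΓ.sphereCount_one_pred h1, ← hΓ.sphereCount_one_succ h1, ← hΓ.card_neighbors y,
    sphereCount, sphereCount, ← Finset.card_union_of_disjoint]
  · congr 1
    ext w
    simp only [Finset.mem_union, Finset.mem_filter, Finset.mem_univ, true_and]
    refine ⟨by tauto, fun hw => ?_⟩
    have h3 := hΓ.connected.dist_triangle (u := y) (v := w) (w := z)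
    have h4 := hΓ.connected.dist_triangle (u := w) (v := y) (w := z)
    have h5 := even_dist_add_dist_add_dist hΓ.connected hbip y w z
    rw [Γ.dist_comm (u := w) (v := y)] at h4
    rw [Nat.even_iff] at h5
    omega
  · refine Finset.disjoint_filter.2 fun w _ h h' => ?_
    omega

end IntersectionNumbers

/-! ### The Bose–Mesner recurrence for the distance matrices. -/

section DistanceMatrices

variable {X : Type*} {Γ : SimpleGraph X}

theorem distanceMatrix_apply (i : ℕ) (y z : X) :
    distanceMatrix Γ i y z = if Γ.dist y z = i then 1 else 0 := rfl

theorem distanceMatrix_zero [DecidableEq X] (hc : Γ.Connected) : distanceMatrix Γ 0 = 1 := by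
  ext y z
  simp [distanceMatrix_apply, Matrix.one_apply, hc.dist_eq_zero_iff]

theorem adjacency_isHermitian : (adjacency Γ).IsHermitian := by
  refine Matrix.IsHermitian.ext fun y z => ?_
  change star (if Γ.dist z y = 1 then (1 : ℂ) else 0) = if Γ.dist y z = 1 then 1 else 0
  rw [Γ.dist_comm (u := z) (v := y)]
  split_ifs <;> simp

variable [Fintype X]

theorem adjacency_mul_distanceMatrix_apply (i : ℕ) (y z : X) :
    (adjacency Γ * distanceMatrix Γ i) y z = sphereCount Γ y z 1 i := by
  simp only [Matrix.mul_apply, distanceMatrix_apply, sphereCount, Finset.card_filter]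
  push_cast
  refine Finset.sum_congr rfl fun w _ => ?_
  by_cases h1 : Γ.dist y w = 1 <;> simp [h1]

theorem distanceMatrix_eq_zero (hΓ : IsDistanceRegular Γ) {i : ℕ} (hi : Γ.diam < i) :
    distanceMatrix Γ i = 0 := by
  ext y z
  have := hΓ.dist_le_diam y z
  rw [distanceMatrix_apply, if_neg (by omega), Matrix.zero_apply]

/-- The three-term recurrence `A A_{i+1} = b_i A_i + c_{i+2} A_{i+2}`. -/
theorem adjacency_mul_distanceMatrix (hΓ : IsDistanceRegular Γ) (hbip : Γ.IsBipartite) (i : ℕ) :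
    adjacency Γ * distanceMatrix Γ (i + 1) =
      (b Γ i : ℂ) • distanceMatrix Γ i + (c Γ (i + 2) : ℂ) • distanceMatrix Γ (i + 2) := by
  ext y z
  rw [adjacency_mul_distanceMatrix_apply, Matrix.add_apply, Matrix.smul_apply, Matrix.smul_apply,
    distanceMatrix_apply, distanceMatrix_apply]
  by_cases h1 : Γ.dist y z = i
  · rw [if_pos h1, if_neg (by omega), hΓ.sphereCount_one_succ h1]
    simp
  by_cases h2 : Γ.dist y z = i + 2
  · rw [if_neg h1, if_pos h2, hΓ.sphereCount_one_pred h2]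
    simp
  · rw [if_neg h1, if_neg h2, sphereCount_one_eq_zero hΓ.connected hbip (by omega) (by omega)]
    simp

/-- `A_i = f_i(A)` for `0 ≤ i ≤ D`. -/
theorem aeval_f [DecidableEq X] (hΓ : IsDistanceRegular Γ) (hbip : Γ.IsBipartite) :
    ∀ i ≤ Γ.diam, Polynomial.aeval (adjacency Γ) (f Γ i) = distanceMatrix Γ i
  | 0, _ => by simp [f, distanceMatrix_zero hΓ.connected]
  | 1, hi => by simp [f, hΓ.c_one hi]
  | i + 2, hi => by
    have hc : (c Γ (i + 2) : ℝ) ≠ 0 := by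
      have := hΓ.c_pos (i := i + 1) hi
      positivity
    have key := adjacency_mul_distanceMatrix hΓ hbip i
    rw [f, map_mul, map_sub, map_mul, map_mul, Polynomial.aeval_X, Polynomial.aeval_C,
      Polynomial.aeval_C, aeval_f hΓ hbip (i + 1) (by omega), aeval_f hΓ hbip i (by omega), key,
      ← Algebra.smul_def, ← Algebra.smul_def, inv_smul_eq_iff₀ hc]
    ext y z
    simp [Matrix.add_apply, Matrix.smul_apply]

/-- The recurrence is solved for A_{i+2}. Indices beyond D are allowed, so later uses need no bound.
-/
theorem distanceMatrix_mem_subconstituentAlgebra [DecidableEq X] (hΓ : IsDistanceRegular Γ)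
    (hbip : Γ.IsBipartite) (hD : 1 ≤ Γ.diam) (x : X) :
    ∀ i, distanceMatrix Γ i ∈ subconstituentAlgebra Γ x
  | 0 => by rw [distanceMatrix_zero hΓ.connected]; exact one_mem _
  | 1 => Algebra.subset_adjoin (Set.mem_insert _ _)
  | i + 2 => by
    rcases Nat.lt_or_ge Γ.diam (i + 2) with hi | hi
    · rw [distanceMatrix_eq_zero hΓ hi]
      exact zero_mem _
    have hc : (c Γ (i + 2) : ℂ) ≠ 0 := by
      have := hΓ.c_pos (i := i + 1) hi
      exact_mod_cast this.ne'
    have key := adjacency_mul_distanceMatrix hΓ hbip i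
    have : distanceMatrix Γ (i + 2) = (c Γ (i + 2) : ℂ)⁻¹ •
        (adjacency Γ * distanceMatrix Γ (i + 1) - (b Γ i : ℂ) • distanceMatrix Γ i) := by
      rw [key, add_sub_cancel_left, inv_smul_smul₀ hc]
    rw [this]
    exact Subalgebra.smul_mem _ (sub_mem
      (mul_mem (Algebra.subset_adjoin (Set.mem_insert _ _))
        (distanceMatrix_mem_subconstituentAlgebra hΓ hbip hD x (i + 1)))
      (Subalgebra.smul_mem _ (distanceMatrix_mem_subconstituentAlgebra hΓ hbip hD x i) _)) _

end DistanceMatrices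

/-! ### Recurrences, degrees and roots of the polynomials f_i and p_i. -/

section Polynomials

variable {X : Type*} [Fintype X] {Γ : SimpleGraph X}

theorem IsDistanceRegular.c_cast_ne_zero (hΓ : IsDistanceRegular Γ) {i : ℕ}
    (hi : i + 1 ≤ Γ.diam) : (c Γ (i + 1) : ℝ) ≠ 0 :=
  Nat.cast_ne_zero.2 (hΓ.c_pos hi).ne'

theorem IsDistanceRegular.b_cast_ne_zero (hΓ : IsDistanceRegular Γ) {i : ℕ}
    (hi : i < Γ.diam) : (b Γ i : ℝ) ≠ 0 :=
  Nat.cast_ne_zero.2 (hΓ.b_pos hi).ne'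

theorem IsDistanceRegular.c_add_b_cast (hΓ : IsDistanceRegular Γ) (hbip : Γ.IsBipartite) {i : ℕ}
    (hi : i ≤ Γ.diam) : (c Γ i : ℝ) + b Γ i = b Γ 0 := by
  exact_mod_cast hΓ.c_add_b hbip hi

theorem p_zero : p Γ 0 = 1 := by
  have : (Finset.range (0 + 1)).filter (fun h => h % 2 = 0 % 2) = {0} := by decide
  rw [p, this, Finset.sum_singleton, f]

theorem p_one : p Γ 1 = f Γ 1 := by
  have : (Finset.range (1 + 1)).filter (fun h => h % 2 = 1 % 2) = {1} := by decide
  rw [p, this, Finset.sum_singleton]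

theorem p_add_two (i : ℕ) : p Γ (i + 2) = f Γ (i + 2) + p Γ i := by
  have : (Finset.range (i + 2 + 1)).filter (fun h => h % 2 = (i + 2) % 2) =
      insert (i + 2) ((Finset.range (i + 1)).filter (fun h => h % 2 = i % 2)) := by
    ext h
    simp only [Finset.mem_filter, Finset.mem_range, Finset.mem_insert]
    omega
  rw [p, p, this, Finset.sum_insert (by simp)]

theorem eval_f_add_two (hΓ : IsDistanceRegular Γ) {i : ℕ} (hi : i + 2 ≤ Γ.diam) (t : ℝ) :
    (c Γ (i + 2) : ℝ) * (f Γ (i + 2)).eval t =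
      t * (f Γ (i + 1)).eval t - b Γ i * (f Γ i).eval t := by
  have := hΓ.c_cast_ne_zero (i := i + 1) hi
  rw [f]
  simp only [Polynomial.eval_mul, Polynomial.eval_sub, Polynomial.eval_C, Polynomial.eval_X]
  field_simp

theorem eval_p_one (hΓ : IsDistanceRegular Γ) (hD : 1 ≤ Γ.diam) (t : ℝ) :
    (p Γ 1).eval t = t := by
  simp [p_one, f, hΓ.c_one hD]

/-- The three-term recurrence `λ p_{i+1} = c_{i+2} p_{i+2} + b_{i+2} p_i`. -/
theorem mul_eval_p (hΓ : IsDistanceRegular Γ) (hbip : Γ.IsBipartite) (t : ℝ) :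
    ∀ i, i + 2 ≤ Γ.diam → t * (p Γ (i + 1)).eval t =
      c Γ (i + 2) * (p Γ (i + 2)).eval t + b Γ (i + 2) * (p Γ i).eval t
  | 0, hi => by
    have h1 := eval_f_add_two hΓ hi t
    have h2 := hΓ.c_add_b_cast hbip hi
    simp only [p_add_two, zero_add, p_zero, p_one, Polynomial.eval_add, Polynomial.eval_one, f]
      at h1 h2 ⊢
    linear_combination -h1 - h2
  | 1, hi => by
    have h1 := eval_f_add_two hΓ hi t
    have h2 := hΓ.c_add_b_cast hbip hi
    have h3 := hΓ.c_add_b_cast hbip (i := 1) (by omega)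
    have h4 := eval_p_one hΓ (by omega) t
    have h5 := hΓ.c_one (by omega)
    rw [p_one] at h4
    simp only [p_add_two, p_zero, p_one, Polynomial.eval_add, Polynomial.eval_one, h4, h5,
      Nat.cast_one, Nat.reduceAdd] at h1 h2 h3 ⊢
    linear_combination -h1 - t * h2 + t * h3
  | i + 2, hi => by
    -- Adding the recurrence for f to the one two indices lower produces k p_{i+2}, and k = c_{i+4}
    -- + b_{i+4} splits it as required.
    have h0 := mul_eval_p hΓ hbip t i (by omega)
    have h1 := eval_f_add_two hΓ hi t
    have h2 := hΓ.c_add_b_cast hbip hi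
    have h3 := hΓ.c_add_b_cast hbip (i := i + 2) (by omega)
    rw [show p Γ (i + 2 + 1) = f Γ (i + 2 + 1) + p Γ (i + 1) from p_add_two (i + 1),
      show p Γ (i + 2 + 2) = f Γ (i + 2 + 2) + p Γ (i + 2) from p_add_two (i + 2),
      Polynomial.eval_add, Polynomial.eval_add]
    have h4 : (p Γ (i + 2)).eval t = (f Γ (i + 2)).eval t + (p Γ i).eval t := by
      rw [p_add_two, Polynomial.eval_add]
    linear_combination -h1 + h0 - (p Γ (i + 2)).eval t * (h2 - h3) - b Γ (i + 2) * h4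

/-- `λ f_D - b_{D-1} f_{D-1}`, written with `D = i + 1`; it annihilates `A`. -/
noncomputable def annihilator (Γ : SimpleGraph X) (i : ℕ) : ℝ[X] :=
  Polynomial.X * f Γ (i + 1) - Polynomial.C (b Γ i : ℝ) * f Γ i

/-- Since A_{D+1} = 0, the recurrence at index D has no upper term. -/
theorem aeval_annihilator [DecidableEq X] (hΓ : IsDistanceRegular Γ) (hbip : Γ.IsBipartite)
    {i : ℕ} (hi : Γ.diam = i + 1) :
    Polynomial.aeval (adjacency Γ) (annihilator Γ i) = 0 := by
  rw [annihilator, map_sub, map_mul, map_mul, Polynomial.aeval_X, Polynomial.aeval_C,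
    aeval_f hΓ hbip _ hi.ge, aeval_f hΓ hbip _ (by omega), adjacency_mul_distanceMatrix hΓ hbip,
    distanceMatrix_eq_zero hΓ (i := i + 2) (by omega), ← Algebra.smul_def]
  ext y z
  simp [Matrix.smul_apply]

theorem natDegree_f_le_and_coeff_ne_zero (hΓ : IsDistanceRegular Γ) :
    ∀ i ≤ Γ.diam, (f Γ i).natDegree ≤ i ∧ (f Γ i).coeff i ≠ 0
  | 0, _ => by simp [f]
  | 1, hi => by
    have := hΓ.c_cast_ne_zero hi
    simp only [f, Polynomial.coeff_C_mul, Polynomial.coeff_X_one, mul_one]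
    exact ⟨(Polynomial.natDegree_C_mul_le _ _).trans Polynomial.natDegree_X_le, inv_ne_zero this⟩
  | i + 2, hi => by
    obtain ⟨h1, h2⟩ := natDegree_f_le_and_coeff_ne_zero hΓ (i + 1) (by omega)
    obtain ⟨h3, -⟩ := natDegree_f_le_and_coeff_ne_zero hΓ i (by omega)
    rw [f]
    constructor
    · refine (Polynomial.natDegree_C_mul_le _ _).trans 
        ((Polynomial.natDegree_sub_le _ _).trans (max_le ?_ ?_))
      · refine Polynomial.natDegree_mul_le.trans ?_
        rw [Polynomial.natDegree_X]
        omega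
      · exact (Polynomial.natDegree_C_mul_le _ _).trans (by omega)
    · rw [Polynomial.coeff_C_mul, Polynomial.coeff_sub, Polynomial.coeff_X_mul,
        Polynomial.coeff_C_mul, Polynomial.coeff_eq_zero_of_natDegree_lt (p := f Γ i) (by omega),
        mul_zero, sub_zero]
      exact mul_ne_zero (inv_ne_zero (hΓ.c_cast_ne_zero (i := i + 1) hi)) h2

theorem annihilator_natDegree_le_and_ne_zero (hΓ : IsDistanceRegular Γ) {i : ℕ}
    (hi : Γ.diam = i + 1) :
    (annihilator Γ i).natDegree ≤ i + 2 ∧ annihilator Γ i ≠ 0 := by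
  obtain ⟨h1, h2⟩ := natDegree_f_le_and_coeff_ne_zero hΓ (i + 1) (by omega)
  obtain ⟨h3, -⟩ := natDegree_f_le_and_coeff_ne_zero hΓ i (by omega)
  constructor
  · refine (Polynomial.natDegree_sub_le _ _).trans (max_le ?_ ?_)
    · refine Polynomial.natDegree_mul_le.trans ?_
      rw [Polynomial.natDegree_X]
      omega
    · exact (Polynomial.natDegree_C_mul_le _ _).trans (by omega)
  · intro h
    have := congrArg (fun g : ℝ[X] => g.coeff (i + 2)) h
    simp only [annihilator, Polynomial.coeff_sub, Polynomial.coeff_X_mul, Polynomial.coeff_C_mul,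
      Polynomial.coeff_eq_zero_of_natDegree_lt (p := f Γ i) (n := i + 2) (by omega), mul_zero,
      sub_zero, Polynomial.coeff_zero] at this
    exact h2 this

/-- Every root of the annihilating polynomial other than `±k` is a root of `p_{D-1}`. -/
theorem eval_p_eq_zero (hΓ : IsDistanceRegular Γ) (hbip : Γ.IsBipartite) {i : ℕ}
    (hi : Γ.diam = i + 3) {t : ℝ} (h : (annihilator Γ (i + 2)).eval t = 0)
    (ht : t ^ 2 ≠ (b Γ 0 : ℝ) ^ 2) : (p Γ (i + 2)).eval t = 0 := by
  have h1 := mul_eval_p hΓ hbip t i (by omega)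
  have h2 := mul_eval_p hΓ hbip t (i + 1) (by omega)
  have h3 := hΓ.c_add_b_cast hbip (i := i + 2) (by omega)
  have h4 := hΓ.c_add_b_cast hbip hi.ge
  have h5 : (p Γ (i + 2)).eval t = (f Γ (i + 2)).eval t + (p Γ i).eval t := by
    rw [p_add_two, Polynomial.eval_add]
  have h6 : (p Γ (i + 3)).eval t = (f Γ (i + 3)).eval t + (p Γ (i + 1)).eval t := by
    rw [show p Γ (i + 3) = f Γ (i + 3) + p Γ (i + 1) from p_add_two (i + 1), Polynomial.eval_add]
  have h7 := hΓ.b_eq_zero hi.le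
  simp only [annihilator, Polynomial.eval_sub, Polynomial.eval_mul, Polynomial.eval_X,
    Polynomial.eval_C, add_assoc, Nat.reduceAdd] at h h2
  rw [h7, Nat.cast_zero] at h4 h2
  -- Here t p_D = k p_{D-1}; since b_D = 0 and c_D = k, also t p_{D-1} = k p_D. Together these give
  -- (t² - k²) p_{D-1} = 0.
  have h8 : t * (p Γ (i + 3)).eval t = b Γ 0 * (p Γ (i + 2)).eval t := by
    linear_combination t * h6 + h + h1 - b Γ (i + 2) * h5 + (p Γ (i + 2)).eval t * h3
  have h9 : (t ^ 2 - (b Γ 0 : ℝ) ^ 2) * (p Γ (i + 2)).eval t = 0 := by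
    linear_combination t * h2 + c Γ (i + 3) * h8 + b Γ 0 * (p Γ (i + 2)).eval t * h4
  exact (mul_eq_zero.1 h9).resolve_left (sub_ne_zero.2 ht)

end Polynomials

/-! ### Functional calculus for real polynomials in a Hermitian matrix. -/

section HermitianPolynomials

variable {X : Type*} [Fintype X] [DecidableEq X] {A : Matrix X X ℂ}

theorem aeval_diagonal_ofReal (d : X → ℝ) (g : ℝ[X]) :
    Polynomial.aeval (Matrix.diagonal fun i => (d i : ℂ)) g =
      Matrix.diagonal fun i => ((g.eval (d i) : ℝ) : ℂ) := by
  induction g using Polynomial.induction_on' with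
  | add g h hg hh => simp [hg, hh]
  | monomial n a =>
    rw [Polynomial.aeval_monomial, Matrix.diagonal_pow, ← Algebra.smul_def]
    ext i j
    rcases eq_or_ne i j with rfl | hij
    · simp
    · simp [hij]

/-- A real polynomial in a Hermitian matrix is diagonalised along with the matrix. -/
theorem aeval_eq_conjStarAlgAut (hA : A.IsHermitian) (g : ℝ[X]) :
    Polynomial.aeval A g = Unitary.conjStarAlgAut ℂ _ hA.eigenvectorUnitary
      (Matrix.diagonal fun i => ((g.eval (hA.eigenvalues i) : ℝ) : ℂ)) := by
  have h := hA.spectral_theorem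
  have h' := Polynomial.aeval_algHom_apply
    ((Unitary.conjStarAlgAut ℂ (Matrix X X ℂ) hA.eigenvectorUnitary).toAlgEquiv.toAlgHom.restrictScalars ℝ)
    (Matrix.diagonal fun i => (hA.eigenvalues i : ℂ)) g
  rw [aeval_diagonal_ofReal] at h'
  conv_lhs => rw [h]
  exact h'

theorem trace_aeval (hA : A.IsHermitian) (g : ℝ[X]) :
    (Polynomial.aeval A g).trace = ((∑ i, g.eval (hA.eigenvalues i) : ℝ) : ℂ) := by
  rw [aeval_eq_conjStarAlgAut hA, Unitary.conjStarAlgAut_apply, Matrix.trace_mul_comm,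
    ← mul_assoc]
  simp [Matrix.trace_diagonal]

/-- A Hermitian matrix is diagonalizable, so vanishing at each eigenvalue once is enough. -/
theorem aeval_eq_zero_of_eval_eq_zero (hA : A.IsHermitian) {g : ℝ[X]}
    (h : ∀ t ∈ spectrum ℝ A, g.eval t = 0) : Polynomial.aeval A g = 0 := by
  rw [hA.spectrum_real_eq_range_eigenvalues] at h
  rw [aeval_eq_conjStarAlgAut hA]
  simp [h _ (Set.mem_range_self _)]

theorem eval_eq_zero_of_aeval_eq_zero {g : ℝ[X]} (h : Polynomial.aeval A g = 0) {t : ℝ}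
    (ht : t ∈ spectrum ℝ A) : g.eval t = 0 := by
  have := spectrum.subset_polynomial_aeval A g ⟨t, ht, rfl⟩
  rw [h] at this
  -- For empty X the matrix ring is trivial and the spectrum is empty.
  have hne : Nonempty X := by
    by_contra hX
    rw [not_nonempty_iff] at hX
    exact ht (isUnit_of_subsingleton _)
  simpa [spectrum.zero_eq] using this

theorem mem_spectrum_real_iff {t : ℝ} :
    t ∈ spectrum ℝ A ↔ ∃ u : X → ℂ, u ≠ 0 ∧ A *ᵥ u = (t : ℂ) • u := by
  rw [← spectrum.algebraMap_mem_iff ℂ, ← Matrix.spectrum_toLin',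
    ← Module.End.hasEigenvalue_iff_mem_spectrum]
  constructor
  · intro h
    obtain ⟨u, hu⟩ := h.exists_hasEigenvector
    exact ⟨u, hu.2, by simpa using hu.apply_eq_smul⟩
  · rintro ⟨u, hu, h⟩
    exact Module.End.hasEigenvalue_of_hasEigenvector (x := u)
      ⟨Module.End.mem_eigenspace_iff.2 (by simpa using h), hu⟩

end HermitianPolynomials

/-! ### The spectrum: symmetry, the bound k, and the count D + 1. -/

section Spectrum

variable {X : Type*} [Fintype X] {Γ : SimpleGraph X}

theorem adjacency_mulVec_apply (u : X → ℂ) (y : X) :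
    (adjacency Γ *ᵥ u) y = ∑ w with Γ.dist y w = 1, u w := by
  simp [Matrix.mulVec, dotProduct, distanceMatrix_apply, Finset.sum_filter]

variable [DecidableEq X]

theorem valency_mem_spectrum (hΓ : IsDistanceRegular Γ) :
    (b Γ 0 : ℝ) ∈ spectrum ℝ (adjacency Γ) := by
  have := hΓ.connected.nonempty
  refine mem_spectrum_real_iff.2 ⟨1, one_ne_zero, ?_⟩
  ext y
  rw [adjacency_mulVec_apply]
  simp [hΓ.card_neighbors y]

/-- Changing the sign of an eigenvector on one color class negates the eigenvalue. -/
theorem neg_mem_spectrum (hbip : Γ.IsBipartite) {t : ℝ} (ht : t ∈ spectrum ℝ (adjacency Γ)) :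
    -t ∈ spectrum ℝ (adjacency Γ) := by
  obtain ⟨u, hu, h⟩ := mem_spectrum_real_iff.1 ht
  obtain ⟨C⟩ := hbip
  refine mem_spectrum_real_iff.2 ⟨fun y => (if C y = 0 then 1 else -1) * u y, ?_, ?_⟩
  · intro h0
    refine hu (funext fun y => ?_)
    have := congrFun h0 y
    by_cases hy : C y = 0 <;> simpa [hy] using this
  · ext y
    have hy := congrFun h y
    rw [adjacency_mulVec_apply] at hy ⊢
    simp only [Pi.smul_apply, smul_eq_mul] at hy ⊢
    have key : ∀ w ∈ Finset.univ.filter (fun w => Γ.dist y w = 1),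
        (if C w = 0 then 1 else -1) * u w = -(if C y = 0 then 1 else -1) * u w := by
      intro w hw
      have hadj : Γ.Adj y w := SimpleGraph.dist_eq_one_iff_adj.1 (Finset.mem_filter.1 hw).2
      have hne := C.valid hadj
      by_cases h1 : C y = 0 <;> by_cases h2 : C w = 0 <;> simp [h1, h2] <;> omega
    rw [Finset.sum_congr rfl key, ← Finset.mul_sum, hy]
    push_cast
    ring

/-- Gershgorin's theorem: the diagonal is zero and the row sums are k. -/
theorem abs_le_valency (hΓ : IsDistanceRegular Γ) {t : ℝ} (ht : t ∈ spectrum ℝ (adjacency Γ)) :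
    |t| ≤ b Γ 0 := by
  rw [← spectrum.algebraMap_mem_iff ℂ, ← Matrix.spectrum_toLin',
    ← Module.End.hasEigenvalue_iff_mem_spectrum] at ht
  obtain ⟨y, hy⟩ := eigenvalue_mem_ball ht
  have h1 : adjacency Γ y y = 0 := by simp [distanceMatrix_apply]
  rw [h1, mem_closedBall_zero_iff] at hy
  have h2 : ‖(algebraMap ℝ ℂ) t‖ = |t| := by simp
  rw [h2] at hy
  refine hy.trans ?_
  rw [← hΓ.card_neighbors y, Finset.card_filter]
  push_cast
  refine (Finset.sum_le_univ_sum_of_nonneg fun _ => norm_nonneg _).trans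
    (Finset.sum_le_sum fun w _ => ?_)
  change ‖if Γ.dist y w = 1 then (1 : ℂ) else 0‖ ≤ _
  split_ifs <;> simp

theorem adjacency_pow_apply (m : ℕ) (y z : X) :
    (adjacency Γ ^ m) y z = Nat.card {q : Γ.Walk y z | q.length = m} := by
  classical
  have : adjacency Γ = Γ.adjMatrix ℂ := by
    ext y z
    simp [distanceMatrix_apply, SimpleGraph.adjMatrix_apply]
  rw [this, SimpleGraph.adjMatrix_pow_apply_eq_card_walk, Nat.card_eq_fintype_card]

theorem adjacency_pow_apply_eq_zero {m : ℕ} {y z : X} (h : m < Γ.dist y z) :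
    (adjacency Γ ^ m) y z = 0 := by
  rw [adjacency_pow_apply, Nat.cast_eq_zero]
  have : IsEmpty {q : Γ.Walk y z | q.length = m} :=
    ⟨fun q => h.not_ge (q.2 ▸ SimpleGraph.dist_le q.1)⟩
  exact Nat.card_of_isEmpty

theorem adjacency_pow_dist_apply_ne_zero (hc : Γ.Connected) (y z : X) :
    (adjacency Γ ^ Γ.dist y z) y z ≠ 0 := by
  classical
  rw [adjacency_pow_apply, Nat.cast_ne_zero, Nat.card_eq_fintype_card]
  obtain ⟨q, hq⟩ := hc.exists_walk_length_eq_dist y z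
  have : Nonempty {q : Γ.Walk y z | q.length = Γ.dist y z} := ⟨⟨q, hq⟩⟩
  exact Fintype.card_ne_zero

/-- A distance-regular graph of diameter `D` has exactly `D + 1` distinct eigenvalues. -/
theorem card_spectrum (hΓ : IsDistanceRegular Γ) (hbip : Γ.IsBipartite) (hD : 1 ≤ Γ.diam) :
    (Matrix.finite_real_spectrum (A := adjacency Γ)).toFinset.card = Γ.diam + 1 := by
  set S := (Matrix.finite_real_spectrum (A := adjacency Γ)).toFinset with hS
  have memS : ∀ t, t ∈ S ↔ t ∈ spectrum ℝ (adjacency Γ) := fun t => by simp [hS]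
  obtain ⟨i, hi⟩ := Nat.exists_eq_add_of_le' hD
  apply le_antisymm
  · obtain ⟨h1, h2⟩ := annihilator_natDegree_le_and_ne_zero hΓ hi
    have h3 : S ⊆ (annihilator Γ i).roots.toFinset := fun t ht => by
      rw [Multiset.mem_toFinset, Polynomial.mem_roots h2]
      exact eval_eq_zero_of_aeval_eq_zero (aeval_annihilator hΓ hbip hi) ((memS t).1 ht)
    have h4 := Finset.card_le_card h3
    have h5 := Multiset.toFinset_card_le (annihilator Γ i).roots
    have h6 := Polynomial.card_roots' (annihilator Γ i)
    omega
  -- With m ≤ D eigenvalues, the product of the X - t would annihilate A. At a pair at distance m,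
  -- however, lower powers of A have entry zero and A^m does not.
  · by_contra! hlt
    obtain ⟨y, -, z, h1, -, -⟩ := exists_geodesic_triple hΓ.connected (Nat.add_zero S.card)
      (Nat.lt_succ_iff.1 hlt)
    have hmonic : (∏ t ∈ S, (Polynomial.X - Polynomial.C t)).Monic :=
      Polynomial.monic_prod_of_monic _ _ fun t _ => Polynomial.monic_X_sub_C t
    have hdeg : (∏ t ∈ S, (Polynomial.X - Polynomial.C t)).natDegree = S.card := by
      rw [Polynomial.natDegree_prod_of_monic _ _ fun t _ => Polynomial.monic_X_sub_C t]
      simp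
    have hzero : Polynomial.aeval (adjacency Γ) (∏ t ∈ S, (Polynomial.X - Polynomial.C t)) = 0 :=
      aeval_eq_zero_of_eval_eq_zero adjacency_isHermitian fun t ht => by
        rw [Polynomial.eval_prod]
        exact Finset.prod_eq_zero ((memS t).2 ht) (by simp)
    have hyz := congrFun (congrFun hzero y) z
    rw [Polynomial.aeval_eq_sum_range, Matrix.sum_apply, Finset.sum_range_succ,
      Finset.sum_eq_zero, zero_add, hmonic.coeff_natDegree, hdeg, one_smul, ← h1] at hyz
    · exact adjacency_pow_dist_apply_ne_zero hΓ.connected y z hyz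
    · intro m hm
      rw [Matrix.smul_apply, adjacency_pow_apply_eq_zero (by
        rw [Finset.mem_range, hdeg] at hm; omega), smul_zero]

end Spectrum

/-! ### Decreasing enumeration of a symmetric set. -/

section SortedLists

/-- If a finite set of reals is symmetric about `0`, so is its decreasing enumeration. -/
theorem sort_getElem_eq_neg {S : Finset ℝ} (hS : ∀ t ∈ S, -t ∈ S) {i j : ℕ}
    (h : i + j + 1 = S.card) (hi : i < (S.sort (fun s t => s ≥ t)).length)
    (hj : j < (S.sort (fun s t => s ≥ t)).length) :
    (S.sort (fun s t => s ≥ t))[i] = -(S.sort (fun s t => s ≥ t))[j] := by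
  -- Negating and reversing the list gives a decreasing list of the same elements, and such a list
  -- is unique.
  have key : ((S.sort (fun s t => s ≥ t)).map Neg.neg).reverse = S.sort (fun s t => s ≥ t) := by
    refine List.Perm.eq_of_pairwise' (r := fun s t : ℝ => s ≥ t) ?_ (Finset.pairwise_sort _ _) ?_
    · rw [List.pairwise_reverse, List.pairwise_map]
      exact (Finset.pairwise_sort S (fun s t => s ≥ t)).imp fun h => neg_le_neg h
    · refine (List.perm_ext_iff_of_nodup ?_ (Finset.sort_nodup _ _)).2 fun t => ?_
      · exact List.nodup_reverse.2 ((Finset.sort_nodup _ _).map neg_injective)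
      · simp only [List.mem_reverse, List.mem_map, Finset.mem_sort]
        exact ⟨by rintro ⟨s, hs, rfl⟩; exact hS s hs, fun ht => ⟨-t, hS t ht, neg_neg t⟩⟩
  have hlen : (S.sort (fun s t => s ≥ t)).length = S.card := Finset.length_sort _
  have := List.getElem_of_eq key.symm hi
  rw [this, List.getElem_reverse, List.getElem_map]
  congr 2
  rw [List.length_map]
  omega

end SortedLists

/-! ### The ordered eigenvalues and the condition θ_n² ≠ b_2. -/

section Eigenvalues

variable {X : Type*} [Fintype X] [DecidableEq X] {Γ : SimpleGraph X}

theorem length_sort_spectrum (hΓ : IsDistanceRegular Γ) (hbip : Γ.IsBipartite)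
    (hD : 1 ≤ Γ.diam) :
    ((Matrix.finite_real_spectrum (A := adjacency Γ)).toFinset.sort (fun s t => s ≥ t)).length =
      Γ.diam + 1 := by
  rw [Finset.length_sort, card_spectrum hΓ hbip hD]

theorem eigenvalue_mem_spectrum (hΓ : IsDistanceRegular Γ) (hbip : Γ.IsBipartite)
    (hD : 1 ≤ Γ.diam) {i : ℕ} (hi : i ≤ Γ.diam) : eigenvalue Γ i ∈ spectrum ℝ (adjacency Γ) := by
  have hlen := length_sort_spectrum hΓ hbip hD
  rw [eigenvalue, List.getD_eq_getElem _ _ (by omega)]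
  exact (Set.Finite.mem_toFinset _).1 ((Finset.mem_sort _).1 (List.getElem_mem _))

theorem exists_eigenvalue_eq (hΓ : IsDistanceRegular Γ) (hbip : Γ.IsBipartite)
    (hD : 1 ≤ Γ.diam) {t : ℝ} (ht : t ∈ spectrum ℝ (adjacency Γ)) :
    ∃ i ≤ Γ.diam, eigenvalue Γ i = t := by
  have hlen := length_sort_spectrum hΓ hbip hD
  have hmem : t ∈ (Matrix.finite_real_spectrum
    (A := adjacency Γ)).toFinset.sort (fun s t => s ≥ t) := by simpa using ht
  obtain ⟨i, hi, rfl⟩ := List.mem_iff_getElem.1 hmem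
  exact ⟨i, by omega, by rw [eigenvalue, List.getD_eq_getElem _ _ hi]⟩

theorem eigenvalue_lt_eigenvalue (hΓ : IsDistanceRegular Γ) (hbip : Γ.IsBipartite)
    (hD : 1 ≤ Γ.diam) {i j : ℕ} (hij : i < j) (hj : j ≤ Γ.diam) :
    eigenvalue Γ j < eigenvalue Γ i := by
  have hlen := length_sort_spectrum hΓ hbip hD
  rw [eigenvalue, eigenvalue, List.getD_eq_getElem _ _ (by omega),
    List.getD_eq_getElem _ _ (by omega)]
  exact List.pairwise_iff_getElem.1 (Finset.sortedGT_sort _).pairwise i j _ _ hij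

theorem eigenvalue_le_eigenvalue (hΓ : IsDistanceRegular Γ) (hbip : Γ.IsBipartite)
    (hD : 1 ≤ Γ.diam) {i j : ℕ} (hij : i ≤ j) (hj : j ≤ Γ.diam) :
    eigenvalue Γ j ≤ eigenvalue Γ i := by
  rcases hij.eq_or_lt with rfl | h
  · exact le_rfl
  · exact (eigenvalue_lt_eigenvalue hΓ hbip hD h hj).le

theorem eigenvalue_eq_neg (hΓ : IsDistanceRegular Γ) (hbip : Γ.IsBipartite)
    (hD : 1 ≤ Γ.diam) {i j : ℕ} (hij : i + j = Γ.diam) : eigenvalue Γ i = -eigenvalue Γ j := by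
  have hlen := length_sort_spectrum hΓ hbip hD
  rw [eigenvalue, eigenvalue, List.getD_eq_getElem _ _ (by omega),
    List.getD_eq_getElem _ _ (by omega)]
  refine sort_getElem_eq_neg (fun t ht => ?_) ?_ _ _
  · simp only [Set.Finite.mem_toFinset] at ht ⊢
    exact neg_mem_spectrum hbip ht
  · rw [card_spectrum hΓ hbip hD, hij]

theorem eigenvalue_zero (hΓ : IsDistanceRegular Γ) (hbip : Γ.IsBipartite) (hD : 1 ≤ Γ.diam) :
    eigenvalue Γ 0 = b Γ 0 := by
  obtain ⟨i, hi, h⟩ := exists_eigenvalue_eq hΓ hbip hD (valency_mem_spectrum hΓ)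
  refine le_antisymm ((le_abs_self _).trans
    (abs_le_valency hΓ (eigenvalue_mem_spectrum hΓ hbip hD (Nat.zero_le _)))) ?_
  rw [← h]
  exact eigenvalue_le_eigenvalue hΓ hbip hD (Nat.zero_le i) hi

omit [DecidableEq X] in
theorem trace_distanceMatrix_succ (i : ℕ) : (distanceMatrix Γ (i + 1)).trace = 0 := by
  simp [Matrix.trace, distanceMatrix_apply]

theorem trace_adjacency_mul_self (hΓ : IsDistanceRegular Γ) (hbip : Γ.IsBipartite) :
    (adjacency Γ * adjacency Γ).trace = b Γ 0 * Fintype.card X := by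
  rw [adjacency_mul_distanceMatrix hΓ hbip 0, Matrix.trace_add, Matrix.trace_smul,
    Matrix.trace_smul, trace_distanceMatrix_succ, distanceMatrix_zero hΓ.connected,
    Matrix.trace_one]
  simp

/-- The recurrence expands A⁴ in distance matrices, of which only A_0 has nonzero trace. -/
theorem trace_adjacency_pow_four (hΓ : IsDistanceRegular Γ) (hbip : Γ.IsBipartite) :
    (adjacency Γ ^ 4).trace = (b Γ 0 + c Γ 2 * b Γ 1) * b Γ 0 * Fintype.card X := by
  have h4 : adjacency Γ ^ 4 = adjacency Γ * (adjacency Γ * (adjacency Γ * adjacency Γ)) := by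
    noncomm_ring
  rw [h4, adjacency_mul_distanceMatrix hΓ hbip 0, distanceMatrix_zero hΓ.connected, mul_add,
    mul_add, mul_smul_comm, mul_smul_comm, mul_smul_comm, mul_smul_comm, mul_one,
    adjacency_mul_distanceMatrix hΓ hbip 1, mul_add, mul_smul_comm, mul_smul_comm,
    Matrix.trace_add, Matrix.trace_smul, Matrix.trace_smul, Matrix.trace_add, Matrix.trace_smul,
    Matrix.trace_smul, adjacency_mul_distanceMatrix hΓ hbip 2, Matrix.trace_add,
    Matrix.trace_smul, Matrix.trace_smul, trace_distanceMatrix_succ, trace_distanceMatrix_succ,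
    trace_adjacency_mul_self hΓ hbip]
  simp only [smul_eq_mul]
  ring

/-- `∑ (k² - θ²)(θ² - b_2) = 0`, summed over the eigenvalues with multiplicity. -/
theorem sum_eigenvalues_eq_zero (hΓ : IsDistanceRegular Γ) (hbip : Γ.IsBipartite)
    (hD : 2 ≤ Γ.diam) :
    ∑ j, ((b Γ 0 : ℝ) ^ 2 - (adjacency_isHermitian (Γ := Γ)).eigenvalues j ^ 2) *
      ((adjacency_isHermitian (Γ := Γ)).eigenvalues j ^ 2 - b Γ 2) = 0 := by
  have h2 := trace_aeval (adjacency_isHermitian (Γ := Γ)) (Polynomial.X ^ 2)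
  have h4 := trace_aeval (adjacency_isHermitian (Γ := Γ)) (Polynomial.X ^ 4)
  simp only [map_pow, Polynomial.aeval_X, Polynomial.eval_pow, Polynomial.eval_X] at h2 h4
  rw [pow_two, trace_adjacency_mul_self hΓ hbip] at h2
  rw [trace_adjacency_pow_four hΓ hbip] at h4
  have h2' : ∑ j, (adjacency_isHermitian (Γ := Γ)).eigenvalues j ^ 2 =
    b Γ 0 * Fintype.card X := by exact_mod_cast h2.symm
  have h4' : ∑ j, (adjacency_isHermitian (Γ := Γ)).eigenvalues j ^ 4 =
    (b Γ 0 + c Γ 2 * b Γ 1) * b Γ 0 * Fintype.card X := by exact_mod_cast h4.symm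
  have hsum : ∀ s : X → ℝ, ∑ j, ((b Γ 0 : ℝ) ^ 2 - s j ^ 2) * (s j ^ 2 - b Γ 2) =
      ((b Γ 0 : ℝ) ^ 2 + b Γ 2) * ∑ j, s j ^ 2 - ∑ j, s j ^ 4 -
        (b Γ 0 : ℝ) ^ 2 * b Γ 2 * Fintype.card X := by
    intro s
    rw [Finset.mul_sum, ← Finset.sum_sub_distrib, mul_comm _ (Fintype.card X : ℝ), ← nsmul_eq_mul,
      ← Finset.card_univ, ← Finset.sum_const, ← Finset.sum_sub_distrib]
    exact Finset.sum_congr rfl fun j _ => by ring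
  have e1 := hΓ.c_add_b_cast hbip (i := 1) (by omega)
  have e2 := hΓ.c_add_b_cast hbip hD
  rw [hΓ.c_one (by omega), Nat.cast_one] at e1
  rw [hsum, h2', h4', ← e1]
  rw [← e1] at e2
  -- By k = 1 + b_1 the sum becomes k b_1 |X| (k - b_2 - c_2), which is zero.
  linear_combination -((1 + (b Γ 1 : ℝ)) * b Γ 1 * Fintype.card X) * e2

/-- If `(k² - θ²)(θ² - b_2)` has constant sign on the spectrum, it vanishes on the spectrum, which
is impossible when there are at least five eigenvalues. -/
theorem false_of_forall_nonneg (hΓ : IsDistanceRegular Γ) (hbip : Γ.IsBipartite)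
    (hD : 4 ≤ Γ.diam) {ε : ℝ} (hε : ε ≠ 0) (h : ∀ t ∈ spectrum ℝ (adjacency Γ),
      0 ≤ ε * (((b Γ 0 : ℝ) ^ 2 - t ^ 2) * (t ^ 2 - b Γ 2))) : False := by
  have hA := adjacency_isHermitian (Γ := Γ)
  have hspec := hA.spectrum_real_eq_range_eigenvalues
  have h0 : ∀ t ∈ spectrum ℝ (adjacency Γ),
      ((b Γ 0 : ℝ) ^ 2 - t ^ 2) * (t ^ 2 - b Γ 2) = 0 := by
    have hs := sum_eigenvalues_eq_zero hΓ hbip (by omega)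
    apply_fun (fun r => ε * r) at hs
    rw [Finset.mul_sum, mul_zero, Finset.sum_eq_zero_iff_of_nonneg fun j _ =>
      h _ (hspec ▸ Set.mem_range_self j)] at hs
    intro t ht
    rw [hspec] at ht
    obtain ⟨j, rfl⟩ := ht
    exact (mul_eq_zero.1 (hs j (Finset.mem_univ j))).resolve_left hε
  have hsub : (Matrix.finite_real_spectrum (A := adjacency Γ)).toFinset ⊆
      {(b Γ 0 : ℝ), -(b Γ 0 : ℝ), √(b Γ 2 : ℝ), -√(b Γ 2 : ℝ)} := by
    intro t ht
    have := h0 t (by simpa using ht)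
    have hb : (0 : ℝ) ≤ b Γ 2 := Nat.cast_nonneg _
    have : ((b Γ 0 : ℝ) ^ 2 = t ^ 2) ∨ (t ^ 2 = √(b Γ 2 : ℝ) ^ 2) := by
      rw [Real.sq_sqrt hb]
      exact (mul_eq_zero.1 this).imp sub_eq_zero.1 sub_eq_zero.1
    rw [eq_comm, sq_eq_sq_iff_eq_or_eq_neg, sq_eq_sq_iff_eq_or_eq_neg] at this
    simpa [or_assoc] using this
  have := (Finset.card_le_card hsub).trans Finset.card_le_four
  rw [card_spectrum hΓ hbip (by omega)] at this
  omega

/-- The eigenvalues `θ_1` and, for odd `D`, `θ_{(D-1)/2}` are positive, smaller than the valency,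
and their square is not `b_2`. -/
theorem eigenvalue_properties (hΓ : IsDistanceRegular Γ) (hbip : Γ.IsBipartite)
    (hD : 4 ≤ Γ.diam) {n : ℕ} (hn : n = 1 ∨ (Odd Γ.diam ∧ n = Γ.diam / 2)) :
    0 < eigenvalue Γ n ∧ eigenvalue Γ n < b Γ 0 ∧ eigenvalue Γ n ^ 2 ≠ b Γ 2 := by
  have hD1 : 1 ≤ Γ.diam := by omega
  have hneg : ∀ i j, i + j = Γ.diam → eigenvalue Γ i = -eigenvalue Γ j :=
    fun i j h => eigenvalue_eq_neg hΓ hbip hD1 h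
  have hle : ∀ i j, i ≤ j → j ≤ Γ.diam → eigenvalue Γ j ≤ eigenvalue Γ i :=
    fun i j h h' => eigenvalue_le_eigenvalue hΓ hbip hD1 h h'
  have hn1 : 1 ≤ n ∧ 2 * n < Γ.diam := by
    rcases hn with rfl | ⟨⟨m, hm⟩, rfl⟩ <;> omega
  have hpos : 0 < eigenvalue Γ n := by
    have h1 := hneg n (Γ.diam - n) (by omega)
    have h2 := eigenvalue_lt_eigenvalue hΓ hbip hD1 (i := n) (j := Γ.diam - n)
      (by omega) (by omega)
    linarith
  refine ⟨hpos, ?_, fun heq => ?_⟩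
  · rw [← eigenvalue_zero hΓ hbip hD1]
    exact eigenvalue_lt_eigenvalue hΓ hbip hD1 (by omega) (by omega)
  have hk : ∀ t ∈ spectrum ℝ (adjacency Γ), 0 ≤ (b Γ 0 : ℝ) ^ 2 - t ^ 2 := fun t ht =>
    sub_nonneg.2 (sq_le_sq.2 ((abs_le_valency hΓ ht).trans (le_abs_self _)))
  -- If b_2 = θ_n², the summands have constant sign. For n = 1 every eigenvalue other than ±k
  -- satisfies θ² ≤ θ_1²; for odd D and n = (D-1)/2, θ_n and θ_{n+1} = -θ_n are closest to zero, so
  -- θ² ≥ θ_n² throughout.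
  rcases hn with rfl | ⟨⟨m, hm⟩, hn⟩
  · refine false_of_forall_nonneg hΓ hbip hD (ε := -1) (by norm_num) fun t ht => ?_
    have h1 := hk t ht
    obtain ⟨i, hi, rfl⟩ := exists_eigenvalue_eq hΓ hbip hD1 ht
    rw [← heq]
    rcases Nat.eq_zero_or_pos i with rfl | hi0
    · rw [eigenvalue_zero hΓ hbip hD1]
      simp
    rcases hi.eq_or_lt with rfl | hiD
    · rw [hneg _ 0 (by omega), eigenvalue_zero hΓ hbip hD1]
      simp
    · have h2 := hle 1 i hi0 hi
      have h3 := hle i (Γ.diam - 1) (by omega) (by omega)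
      rw [hneg (Γ.diam - 1) 1 (by omega)] at h3
      have h4 := sq_le_sq.2 ((abs_le.2 ⟨h3, h2⟩).trans (le_abs_self _))
      nlinarith
  · refine false_of_forall_nonneg hΓ hbip hD (ε := 1) one_ne_zero fun t ht => ?_
    have h1 := hk t ht
    obtain ⟨i, hi, rfl⟩ := exists_eigenvalue_eq hΓ hbip hD1 ht
    rw [← heq, one_mul]
    refine mul_nonneg h1 (sub_nonneg.2 (sq_le_sq.2 ?_))
    rw [abs_of_pos hpos]
    rcases Nat.lt_or_ge n i with h | h
    · have h2 := hle (n + 1) i h hi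
      rw [hneg (n + 1) n (by omega)] at h2
      exact (le_neg_of_le_neg h2).trans (neg_le_abs _)
    · exact (hle i n h (by omega)).trans (le_abs_self _)

/-- `θ_n` is a root of `p_{D-1}`. -/
theorem eval_p_eigenvalue_eq_zero (hΓ : IsDistanceRegular Γ) (hbip : Γ.IsBipartite)
    (hD : 4 ≤ Γ.diam) {n : ℕ} (hn : n = 1 ∨ (Odd Γ.diam ∧ n = Γ.diam / 2)) :
    (p Γ (Γ.diam - 1)).eval (eigenvalue Γ n) = 0 := by
  obtain ⟨h0, h1, -⟩ := eigenvalue_properties hΓ hbip hD hn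
  obtain ⟨i, hi⟩ := Nat.exists_eq_add_of_le' (show 3 ≤ Γ.diam by omega)
  rw [hi]
  refine eval_p_eq_zero hΓ hbip hi (eval_eq_zero_of_aeval_eq_zero
    (aeval_annihilator hΓ hbip hi) (eigenvalue_mem_spectrum hΓ hbip (by omega) ?_)) ?_
  · rcases hn with rfl | ⟨-, rfl⟩ <;> omega
  · exact (sq_lt_sq.2 (by rw [abs_of_pos h0]; exact h1.trans_le (le_abs_self _))).ne

end Eigenvalues

/-! ### Dual idempotents and the splitting of A into raising and lowering parts. -/

section DualIdempotents

variable {X : Type*} [Fintype X] [DecidableEq X] {Γ : SimpleGraph X}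

theorem dualIdempotent_mulVec_apply (x : X) (i : ℕ) (u : X → ℂ) (y : X) :
    (dualIdempotent Γ x i *ᵥ u) y = if Γ.dist x y = i then u y else 0 := by
  rw [dualIdempotent, Matrix.mulVec_diagonal, ite_mul, one_mul, zero_mul]

theorem dualIdempotent_mulVec_self {x : X} {i : ℕ} {u : X → ℂ}
    (hu : ∀ y, u y ≠ 0 → Γ.dist x y = i) : dualIdempotent Γ x i *ᵥ u = u := by
  ext y
  rw [dualIdempotent_mulVec_apply]
  split_ifs with h
  · rfl
  · exact (not_not.1 (mt (hu y) h)).symm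

theorem dualIdempotent_mulVec_eq_zero {x : X} {i j : ℕ} (hij : j ≠ i) {u : X → ℂ}
    (hu : ∀ y, u y ≠ 0 → Γ.dist x y = i) : dualIdempotent Γ x j *ᵥ u = 0 := by
  ext y
  rw [dualIdempotent_mulVec_apply, Pi.zero_apply]
  split_ifs with h
  · exact not_not.1 (mt (hu y) (h ▸ hij))
  · rfl

omit [Fintype X] in
theorem dualIdempotent_isHermitian (x : X) (i : ℕ) : (dualIdempotent Γ x i).IsHermitian := by
  refine Matrix.isHermitian_diagonal_of_self_adjoint _ (funext fun y => ?_)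
  change star (if Γ.dist x y = i then (1 : ℂ) else 0) = _
  split_ifs <;> simp

omit [Fintype X] [DecidableEq X] in
/-- In a bipartite graph the neighbors of a vertex at distance `i + 1` from `x` are at distance `i`
or `i + 2` from `x`. -/
theorem dist_eq_or_of_dist_eq_one (hc : Γ.Connected) (hbip : Γ.IsBipartite) {x y w : X} {i : ℕ}
    (hy : Γ.dist x y = i + 1) (hw : Γ.dist y w = 1) : Γ.dist x w = i ∨ Γ.dist x w = i + 2 := by
  have h3 := hc.dist_triangle (u := x) (v := y) (w := w)
  have h4 := hc.dist_triangle (u := x) (v := w) (w := y)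
  have h5 := even_dist_add_dist_add_dist hc hbip x y w
  rw [Γ.dist_comm (u := w) (v := y)] at h4
  rw [Nat.even_iff] at h5
  omega

/-- `E*_{i+1} A = E*_{i+1} A E*_i + E*_{i+1} A E*_{i+2}`. -/
theorem dualIdempotent_adjacency_mulVec (hc : Γ.Connected) (hbip : Γ.IsBipartite) (x : X) (i : ℕ)
    (u : X → ℂ) : dualIdempotent Γ x (i + 1) *ᵥ (adjacency Γ *ᵥ u) =
      dualIdempotent Γ x (i + 1) *ᵥ (adjacency Γ *ᵥ (dualIdempotent Γ x i *ᵥ u)) +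
      dualIdempotent Γ x (i + 1) *ᵥ (adjacency Γ *ᵥ (dualIdempotent Γ x (i + 2) *ᵥ u)) := by
  ext y
  simp only [Pi.add_apply, dualIdempotent_mulVec_apply, adjacency_mulVec_apply]
  split_ifs with hy
  · rw [← Finset.sum_add_distrib]
    refine Finset.sum_congr rfl fun w hw => ?_
    rcases dist_eq_or_of_dist_eq_one hc hbip hy (Finset.mem_filter.1 hw).2 with h | h <;> simp [h]
  · simp

/-- `A E*_{i+1} = E*_i A E*_{i+1} + E*_{i+2} A E*_{i+1}`. -/
theorem adjacency_mulVec_eq_add (hc : Γ.Connected) (hbip : Γ.IsBipartite) {x : X} {i : ℕ}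
    {u : X → ℂ} (hu : ∀ y, u y ≠ 0 → Γ.dist x y = i + 1) : adjacency Γ *ᵥ u =
      dualIdempotent Γ x (i + 2) *ᵥ (adjacency Γ *ᵥ u) +
      dualIdempotent Γ x i *ᵥ (adjacency Γ *ᵥ u) := by
  ext y
  simp only [Pi.add_apply, dualIdempotent_mulVec_apply, adjacency_mulVec_apply]
  by_cases h1 : Γ.dist x y = i
  · simp [h1]
  by_cases h2 : Γ.dist x y = i + 2
  · simp [h2]
  rw [if_neg h1, if_neg h2, add_zero]
  refine Finset.sum_eq_zero fun w hw => ?_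
  by_contra hne
  have hyw := (Finset.mem_filter.1 hw).2
  rw [Γ.dist_comm] at hyw
  rcases dist_eq_or_of_dist_eq_one hc hbip (hu w hne) hyw with h | h
  · exact h1 h
  · exact h2 h

end DualIdempotents

/-! ### Relations among the vectors E*_i A_j v. -/

section LocalVectors

variable {X : Type*} [Fintype X] [DecidableEq X] {Γ : SimpleGraph X}

/-- The vector `E*_i A_j v`. -/
noncomputable def localVector (Γ : SimpleGraph X) (x : X) (v : X → ℂ) (i j : ℕ) : X → ℂ :=
  (dualIdempotent Γ x i * distanceMatrix Γ j) *ᵥ v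

variable {x : X} {v : X → ℂ}

theorem localVector_eq (i j : ℕ) :
    localVector Γ x v i j = dualIdempotent Γ x i *ᵥ (distanceMatrix Γ j *ᵥ v) :=
  (Matrix.mulVec_mulVec _ _ _).symm

theorem localVector_apply (i j : ℕ) (y : X) : localVector Γ x v i j y =
    if Γ.dist x y = i then ∑ w with Γ.dist y w = j, v w else 0 := by
  rw [localVector_eq, dualIdempotent_mulVec_apply]
  simp [Matrix.mulVec, dotProduct, distanceMatrix_apply, Finset.sum_filter]

theorem dist_eq_of_localVector_ne_zero {i j : ℕ} (y : X) (h : localVector Γ x v i j y ≠ 0) :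
    Γ.dist x y = i := by
  rw [localVector_apply] at h
  by_contra hne
  exact h (if_neg hne)

theorem localVector_two_zero (hc : Γ.Connected) (hv : ∀ w, v w ≠ 0 → Γ.dist x w = 2) :
    localVector Γ x v 2 0 = v := by
  rw [localVector_eq, distanceMatrix_zero hc, Matrix.one_mulVec, dualIdempotent_mulVec_self hv]

/-- By the triangle inequality, a vertex at distance i from x is at distance between i - 2 and i + 2
from the support of v. -/
theorem localVector_eq_zero (hc : Γ.Connected) {i j : ℕ} (hv : ∀ w, v w ≠ 0 → Γ.dist x w = 2)
    (h : j + 2 < i ∨ i + 2 < j) : localVector Γ x v i j = 0 := by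
  ext y
  rw [localVector_apply, Pi.zero_apply]
  split_ifs with hy
  · refine Finset.sum_eq_zero fun w hw => ?_
    by_contra hne
    have h0 := hv w hne
    have h1 := (Finset.mem_filter.1 hw).2
    have h3 := hc.dist_triangle (u := x) (v := w) (w := y)
    have h4 := hc.dist_triangle (u := y) (v := x) (w := w)
    rw [Γ.dist_comm (u := w) (v := y)] at h3
    rw [Γ.dist_comm (u := y) (v := x)] at h4
    omega
  · rfl

/-- If the entries of `v` sum to zero, the three nonzero vectors `E*_{r+2} A_j v` sum to zero. -/
theorem localVector_add_add (hc : Γ.Connected) (hbip : Γ.IsBipartite)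
    (hv : ∀ w, v w ≠ 0 → Γ.dist x w = 2) (hsum : ∑ w, v w = 0) (r : ℕ) :
    localVector Γ x v (r + 2) r + localVector Γ x v (r + 2) (r + 2) +
      localVector Γ x v (r + 2) (r + 4) = 0 := by
  ext y
  simp only [Pi.add_apply, localVector_apply, Pi.zero_apply]
  split_ifs with hy
  · rw [← hsum, Finset.sum_filter, Finset.sum_filter, Finset.sum_filter, ← Finset.sum_add_distrib,
      ← Finset.sum_add_distrib]
    refine Finset.sum_congr rfl fun w _ => ?_
    by_cases hne : v w = 0
    · simp [hne]
    have h0 := hv w hne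
    have h3 := hc.dist_triangle (u := x) (v := w) (w := y)
    have h4 := hc.dist_triangle (u := y) (v := x) (w := w)
    have h5 := even_dist_add_dist_add_dist hc hbip x y w
    rw [Γ.dist_comm (u := w) (v := y)] at h3
    rw [Γ.dist_comm (u := y) (v := x)] at h4
    rw [Nat.even_iff] at h5
    have h6 : Γ.dist y w = r ∨ Γ.dist y w = r + 2 ∨ Γ.dist y w = r + 4 := by omega
    rcases h6 with h | h | h <;> simp [h]
  · simp

/-- The recurrence for A A_{j+1}, cut by E*_{i+1} on the left, with the middle split over the two
adjacent spheres. The raising and lowering rules are special cases in which some terms vanish. -/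
theorem adjacency_localVector_add (hΓ : IsDistanceRegular Γ) (hbip : Γ.IsBipartite) (i j : ℕ) :
    dualIdempotent Γ x (i + 1) *ᵥ (adjacency Γ *ᵥ localVector Γ x v i (j + 1)) +
      dualIdempotent Γ x (i + 1) *ᵥ (adjacency Γ *ᵥ localVector Γ x v (i + 2) (j + 1)) =
    (b Γ j : ℂ) • localVector Γ x v (i + 1) j +
      (c Γ (j + 2) : ℂ) • localVector Γ x v (i + 1) (j + 2) := by
  simp only [localVector_eq]
  rw [← dualIdempotent_adjacency_mulVec hΓ.connected hbip,
    Matrix.mulVec_mulVec _ (adjacency Γ),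
    adjacency_mul_distanceMatrix hΓ hbip, Matrix.add_mulVec, Matrix.smul_mulVec,
    Matrix.smul_mulVec, Matrix.mulVec_add, Matrix.mulVec_smul, Matrix.mulVec_smul]

/-- `E*_{r+3} A` maps `E*_{r+2} A_r v` to `c_{r+1} E*_{r+3} A_{r+1} v`. -/
theorem raise_localVector (hΓ : IsDistanceRegular Γ) (hbip : Γ.IsBipartite) (hD : 1 ≤ Γ.diam)
    (hv : ∀ w, v w ≠ 0 → Γ.dist x w = 2) (r : ℕ) :
    dualIdempotent Γ x (r + 3) *ᵥ (adjacency Γ *ᵥ localVector Γ x v (r + 2) r) =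
      (c Γ (r + 1) : ℂ) • localVector Γ x v (r + 3) (r + 1) := by
  rcases r with _ | r
  -- The general relation involves A_{j+1} on the left, so A_0 is treated apart.
  · rw [localVector_two_zero hΓ.connected hv, localVector_eq, hΓ.c_one hD, Nat.cast_one, one_smul]
  · have h := adjacency_localVector_add (x := x) (v := v) hΓ hbip (r + 3) r
    rw [localVector_eq_zero hΓ.connected (i := r + 3 + 2) (j := r + 1) hv (by omega),
      localVector_eq_zero hΓ.connected (i := r + 3 + 1) (j := r) hv (by omega), smul_zero,
      Matrix.mulVec_zero, Matrix.mulVec_zero, zero_add, add_zero] at h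
    exact h

/-- `E*_{r+2} A` maps `E*_{r+3} A_{r+5} v` to `b_{r+4} E*_{r+2} A_{r+4} v`. -/
theorem lower_localVector (hΓ : IsDistanceRegular Γ) (hbip : Γ.IsBipartite)
    (hv : ∀ w, v w ≠ 0 → Γ.dist x w = 2) (r : ℕ) :
    dualIdempotent Γ x (r + 2) *ᵥ (adjacency Γ *ᵥ localVector Γ x v (r + 3) (r + 5)) =
      (b Γ (r + 4) : ℂ) • localVector Γ x v (r + 2) (r + 4) := by
  have h := adjacency_localVector_add (x := x) (v := v) hΓ hbip (r + 1) (r + 4)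
  rw [localVector_eq_zero hΓ.connected (i := r + 1) (j := r + 4 + 1) hv (by omega),
    localVector_eq_zero hΓ.connected (i := r + 1 + 1) (j := r + 4 + 2) hv (by omega), smul_zero,
    Matrix.mulVec_zero, Matrix.mulVec_zero, zero_add, add_zero] at h
  exact h

open scoped ComplexOrder in
/-- The raising and lowering maps are adjoint, so `E*_{r+3} A_{r+1} v` vanishes as soon as
`E*_{r+2} A` annihilates it. -/
theorem localVector_eq_zero_of_lower_eq_zero (hΓ : IsDistanceRegular Γ) (hbip : Γ.IsBipartite)
    (hv : ∀ w, v w ≠ 0 → Γ.dist x w = 2) {r : ℕ} (hr : r + 1 ≤ Γ.diam)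
    (h : dualIdempotent Γ x (r + 2) *ᵥ (adjacency Γ *ᵥ localVector Γ x v (r + 3) (r + 1)) = 0) :
    localVector Γ x v (r + 3) (r + 1) = 0 := by
  set u := localVector Γ x v (r + 3) (r + 1) with hu
  set u' := localVector Γ x v (r + 2) r with hu'
  have hE : dualIdempotent Γ x (r + 3) *ᵥ u = u :=
    dualIdempotent_mulVec_self dist_eq_of_localVector_ne_zero
  have hE' : dualIdempotent Γ x (r + 2) *ᵥ u' = u' :=
    dualIdempotent_mulVec_self dist_eq_of_localVector_ne_zero
  have key : ∀ {M : Matrix X X ℂ}, M.IsHermitian → ∀ a a' : X → ℂ,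
      star a ⬝ᵥ (M *ᵥ a') = star (M *ᵥ a) ⬝ᵥ a' := fun hM a a' => by
    rw [Matrix.star_mulVec, hM.eq, Matrix.dotProduct_mulVec]
  -- c_{r+1} ‖u‖² is the inner product of u with the raised u', hence of the lowered u with u',
  -- which is zero.
  have h1 : star u ⬝ᵥ ((c Γ (r + 1) : ℂ) • u) = 0 := by
    rw [← raise_localVector hΓ hbip (by omega) hv, key (dualIdempotent_isHermitian _ _), hE,
      key adjacency_isHermitian, ← hu', ← hE', key (dualIdempotent_isHermitian _ _), h]
    simp
  rw [dotProduct_smul, smul_eq_mul, mul_eq_zero, dotProduct_star_self_eq_zero] at h1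
  exact h1.resolve_left (Nat.cast_ne_zero.2 (hΓ.c_pos hr).ne')

end LocalVectors

/-! ### T-modules and their dual components. -/

section Modules

variable {X : Type*} [Fintype X] [DecidableEq X] {Γ : SimpleGraph X} {x : X} {v : X → ℂ}
  {W : Submodule ℂ (X → ℂ)}

theorem dualIdempotent_mem_subconstituentAlgebra (i : ℕ) :
    dualIdempotent Γ x i ∈ subconstituentAlgebra Γ x :=
  Algebra.subset_adjoin (Set.mem_insert_of_mem _ (Set.mem_range_self i))

/-- A subspace stable under `A` and the dual idempotents is a `T`-module. -/
theorem isTModule_of_stable (hA : ∀ w ∈ W, adjacency Γ *ᵥ w ∈ W)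
    (hE : ∀ i, ∀ w ∈ W, dualIdempotent Γ x i *ᵥ w ∈ W) : IsTModule Γ x W := by
  intro B hB
  induction hB using Algebra.adjoin_induction with
  | mem B hB =>
    rcases hB with rfl | ⟨i, rfl⟩
    · exact hA
    · exact hE i
  | algebraMap r =>
    intro w hw
    rw [Algebra.algebraMap_eq_smul_one, Matrix.smul_mulVec, Matrix.one_mulVec]
    exact W.smul_mem _ hw
  | add B C _ _ hB hC =>
    intro w hw
    rw [Matrix.add_mulVec]
    exact W.add_mem (hB w hw) (hC w hw)
  | mul B C _ _ hB hC =>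
    intro w hw
    rw [← Matrix.mulVec_mulVec]
    exact hB _ (hC w hw)

theorem mem_of_mem_dualComponent (hW : IsTModule Γ x W) {i : ℕ} {u : X → ℂ}
    (hu : u ∈ dualComponent Γ x W i) : u ∈ W := by
  obtain ⟨w, hw, rfl⟩ := hu
  exact hW _ (dualIdempotent_mem_subconstituentAlgebra i) w hw

theorem dist_eq_of_mem_dualComponent {i : ℕ} {u : X → ℂ} (hu : u ∈ dualComponent Γ x W i) (y : X)
    (hy : u y ≠ 0) : Γ.dist x y = i := by
  obtain ⟨w, -, rfl⟩ := hu
  rw [Matrix.mulVecLin_apply, dualIdempotent_mulVec_apply] at hy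
  by_contra hne
  exact hy (if_neg hne)

theorem dualIdempotent_mulVec_mem_dualComponent (i : ℕ) {w : X → ℂ} (hw : w ∈ W) :
    dualIdempotent Γ x i *ᵥ w ∈ dualComponent Γ x W i :=
  ⟨w, hw, rfl⟩

theorem dualComponent_eq_bot_of_lt_endpoint {i : ℕ} (h : i < endpoint Γ x W) (hi : i ≤ Γ.diam) :
    dualComponent Γ x W i = ⊥ := by
  by_contra hne
  exact Nat.notMem_of_lt_sInf h ⟨hi, hne⟩

theorem localVector_mem_dualComponent (hΓ : IsDistanceRegular Γ) (hbip : Γ.IsBipartite)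
    (hD : 1 ≤ Γ.diam) (hW : IsTModule Γ x W) (hv : v ∈ W) (i j : ℕ) :
    localVector Γ x v i j ∈ dualComponent Γ x W i := by
  rw [localVector_eq]
  exact dualIdempotent_mulVec_mem_dualComponent i
    (hW _ (distanceMatrix_mem_subconstituentAlgebra hΓ hbip hD x j) v hv)

/-- The entries of a vector of `E*_2 W` sum to zero if `E*_0 W = 0`. -/
theorem sum_eq_zero_of_dualComponent_zero_eq_bot (hΓ : IsDistanceRegular Γ) (hbip : Γ.IsBipartite)
    (hD : 1 ≤ Γ.diam) (hW : IsTModule Γ x W) (h0 : dualComponent Γ x W 0 = ⊥)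
    (hv : v ∈ dualComponent Γ x W 2) : ∑ w, v w = 0 := by
  -- The entry at x of E*_0 A_2 v is the sum of the entries of v.
  have h := localVector_mem_dualComponent hΓ hbip hD hW (mem_of_mem_dualComponent hW hv) 0 2
  rw [h0, Submodule.mem_bot] at h
  have hx := congrFun h x
  rw [localVector_apply, if_pos Γ.dist_self, Finset.sum_filter, Pi.zero_apply] at hx
  rw [← hx]
  refine Finset.sum_congr rfl fun w _ => ?_
  split_ifs with hw
  · rfl
  · exact not_not.1 (mt (dist_eq_of_mem_dualComponent hv w) hw)

end Modules

/-! ### Scalar identities linking ω_i, α_r and the p_i. -/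

section Coefficients

variable {X : Type*} [Fintype X] {Γ : SimpleGraph X}

/-- The scalar `α_r` with `E*_{r+2} A_{r+4} v = -α_r E*_{r+2} A_r v`. -/
noncomputable def localRatio (Γ : SimpleGraph X) (t : ℝ) (r : ℕ) : ℝ :=
  -((b Γ (r + 2) : ℝ) * b Γ (r + 3) / (c Γ (r + 1) * c Γ (r + 2)) *
    ((p Γ r).eval t / (p Γ (r + 2)).eval t))

/-- This is where the special form of the local eigenvalue enters, through c_2 p_2(t) = t² - b_2. -/
theorem localRatio_zero (hΓ : IsDistanceRegular Γ) (hbip : Γ.IsBipartite) (hD : 2 ≤ Γ.diam)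
    {t : ℝ} (ht : t ^ 2 ≠ b Γ 2) : 1 + tilde Γ t = localRatio Γ t 0 := by
  have h1 := mul_eval_p hΓ hbip t 0 hD
  have hc := hΓ.c_cast_ne_zero (i := 1) hD
  rw [zero_add, zero_add, eval_p_one hΓ (by omega), p_zero, Polynomial.eval_one, mul_one] at h1
  have h2 : (p Γ 2).eval t = (t ^ 2 - b Γ 2) / c Γ 2 := by
    rw [eq_div_iff hc]
    linear_combination -h1
  have h3 := sub_ne_zero.2 ht
  rw [localRatio, tilde, zero_add, zero_add, zero_add, h2, p_zero, Polynomial.eval_one,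
    hΓ.c_one (by omega), Nat.cast_one]
  field_simp
  ring

theorem eval_p_two_ne_zero (hΓ : IsDistanceRegular Γ) (hbip : Γ.IsBipartite) (hD : 2 ≤ Γ.diam)
    {t : ℝ} (ht : t ^ 2 ≠ b Γ 2) : (p Γ 2).eval t ≠ 0 := by
  have h1 := mul_eval_p hΓ hbip t 0 hD
  intro h
  rw [zero_add, zero_add, eval_p_one hΓ (by omega), p_zero, Polynomial.eval_one, mul_one, h] at h1
  exact ht (by linear_combination h1)

theorem omega_one_eq (hΓ : IsDistanceRegular Γ) (hbip : Γ.IsBipartite) (hD : 3 ≤ Γ.diam)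
    {t : ℝ} (h1 : (p Γ 1).eval t ≠ 0) (h2 : (p Γ 2).eval t ≠ 0) :
    omega Γ t 1 = b Γ 0 + c Γ 2 * (localRatio Γ t 0 - 1) := by
  have r0 := mul_eval_p hΓ hbip t 1 hD
  have e := hΓ.c_add_b_cast hbip (i := 2) (by omega)
  have c1 := hΓ.c_one (by omega)
  have c2 := hΓ.c_cast_ne_zero (i := 1) (by omega)
  have p1 := eval_p_one hΓ (by omega) t
  rw [p1] at h1 r0
  simp only [Nat.reduceAdd] at r0
  simp only [omega, localRatio, Nat.sub_self, p_zero, p1, c1, Nat.cast_one, Polynomial.eval_one,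
    Nat.reduceAdd, zero_add]
  field_simp
  linear_combination t * (p Γ 2).eval t * e - (b Γ 2 : ℝ) * r0

/-- The right side is the coefficient that the lowering computation produces. Clearing denominators
reduces the equality to two instances of the recurrence for p and c_{r+3} + b_{r+3} = c_{r+1} +
b_{r+1}. -/
theorem omega_succ_succ_eq (hΓ : IsDistanceRegular Γ) (hbip : Γ.IsBipartite) {r : ℕ}
    (hD : r + 4 ≤ Γ.diam) {t : ℝ} (h1 : (p Γ (r + 2)).eval t ≠ 0)
    (h2 : (p Γ (r + 3)).eval t ≠ 0) :
    omega Γ t (r + 2) = b Γ (r + 1) + c Γ (r + 3) * (localRatio Γ t (r + 1) - 1) -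
      c Γ (r + 1) * (localRatio Γ t r - 1) := by
  have r0 := mul_eval_p hΓ hbip t (r + 2) hD
  have r1 := mul_eval_p hΓ hbip t r (by omega)
  have e := hΓ.c_add_b_cast hbip (i := r + 3) (by omega)
  have e' := hΓ.c_add_b_cast hbip (i := r + 1) (by omega)
  have c1 := hΓ.c_cast_ne_zero (i := r) (by omega)
  have c2 := hΓ.c_cast_ne_zero (i := r + 1) (by omega)
  have c3 := hΓ.c_cast_ne_zero (i := r + 2) (by omega)
  simp only [add_assoc, Nat.reduceAdd] at r0 r1 e e' c1 c2 c3
  simp only [omega, localRatio, add_assoc, Nat.reduceAdd, Nat.reduceSubDiff]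
  field_simp
  linear_combination (b Γ (r + 3) : ℝ) * ((p Γ (r + 3)).eval t * r1 - (p Γ (r + 1)).eval t * r0) +
    c Γ (r + 2) * (p Γ (r + 2)).eval t * (p Γ (r + 3)).eval t * (e - e')

/-- The compatibility that carries the induction from α_r to α_{r+1}; it is pure cancellation. -/
theorem localRatio_succ_mul_omega (hΓ : IsDistanceRegular Γ) {r : ℕ}
    (hD : r + 3 ≤ Γ.diam) {t : ℝ} (h0 : (p Γ r).eval t ≠ 0) (h1 : (p Γ (r + 1)).eval t ≠ 0)
    (h2 : (p Γ (r + 2)).eval t ≠ 0) (h3 : (p Γ (r + 3)).eval t ≠ 0) :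
    localRatio Γ t (r + 1) * omega Γ t (r + 1) = b Γ (r + 4) * localRatio Γ t r := by
  have c1 := hΓ.c_cast_ne_zero (i := r) (by omega)
  have c2 := hΓ.c_cast_ne_zero (i := r + 1) (by omega)
  have c3 := hΓ.c_cast_ne_zero (i := r + 2) (by omega)
  simp only [add_assoc, Nat.reduceAdd] at c1 c2 c3
  simp only [omega, localRatio, add_assoc, Nat.reduceAdd, Nat.add_sub_cancel]
  field_simp

theorem localRatio_ne_zero (hΓ : IsDistanceRegular Γ) {r : ℕ} (hD : r + 4 ≤ Γ.diam) {t : ℝ}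
    (h0 : (p Γ r).eval t ≠ 0) (h2 : (p Γ (r + 2)).eval t ≠ 0) : localRatio Γ t r ≠ 0 := by
  have c1 := hΓ.c_cast_ne_zero (i := r) (by omega)
  have c2 := hΓ.c_cast_ne_zero (i := r + 1) (by omega)
  have b1 := hΓ.b_cast_ne_zero (i := r + 2) (by omega)
  have b2 := hΓ.b_cast_ne_zero (i := r + 3) (by omega)
  exact neg_ne_zero.2 (mul_ne_zero (div_ne_zero (mul_ne_zero b1 b2) (mul_ne_zero c1 c2))
    (div_ne_zero h0 h2))

/-- The factor p_{r+3} of ω_{r+1} links the module to the polynomials: nonzero ω yields the next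
denominator, and the root of p_{D-1} ends the chain. -/
theorem eval_p_ne_zero_of_omega_ne_zero {r : ℕ} {t : ℝ} (h : omega Γ t (r + 1) ≠ 0) :
    (p Γ (r + 3)).eval t ≠ 0 := by
  intro h0
  rw [omega, show r + 1 + 2 = r + 3 from rfl, h0] at h
  simp at h

theorem omega_eq_zero {r : ℕ} {t : ℝ} (h : (p Γ (r + 3)).eval t = 0) :
    omega Γ t (r + 1) = 0 := by
  rw [omega, show r + 1 + 2 = r + 3 from rfl, h]
  simp

end Coefficients

/-! ### The inductive structure of W and the action of A. -/

section ThinModules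

variable {X : Type*} [Fintype X] [DecidableEq X] {Γ : SimpleGraph X} {x : X} {v : X → ℂ}
  {W : Submodule ℂ (X → ℂ)} {t : ℝ}

theorem localVector_diagonal_eq (hc : Γ.Connected) (hbip : Γ.IsBipartite)
    (hv : ∀ w, v w ≠ 0 → Γ.dist x w = 2) (hsum : ∑ w, v w = 0) {r : ℕ} {a : ℂ}
    (h : localVector Γ x v (r + 2) (r + 4) = -a • localVector Γ x v (r + 2) r) :
    localVector Γ x v (r + 2) (r + 2) = (a - 1) • localVector Γ x v (r + 2) r := by
  have h' := localVector_add_add hc hbip hv hsum r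
  rw [h] at h'
  rw [sub_smul, one_smul, ← sub_eq_zero, ← h']
  module

/-- `E*_{r+2} A` maps `E*_{r+3} A_{r+1} v` to `ω_{r+1} E*_{r+2} A_r v`. -/
theorem lower_localVector_eq_omega_smul (hΓ : IsDistanceRegular Γ) (hbip : Γ.IsBipartite)
    (hv : ∀ w, v w ≠ 0 → Γ.dist x w = 2) (hsum : ∑ w, v w = 0)
    (h1 : localVector Γ x v 1 1 = 0) {r : ℕ} (hr : r + 3 ≤ Γ.diam)
    (ht : ∀ j ≤ r, localVector Γ x v (j + 2) (j + 4) =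
      -(localRatio Γ t j : ℂ) • localVector Γ x v (j + 2) j)
    (hp : ∀ j ≤ r + 2, (p Γ j).eval t ≠ 0) :
    dualIdempotent Γ x (r + 2) *ᵥ (adjacency Γ *ᵥ localVector Γ x v (r + 3) (r + 1)) =
      (omega Γ t (r + 1) : ℂ) • localVector Γ x v (r + 2) r := by
  have hs := fun j hj => localVector_diagonal_eq hΓ.connected hbip hv hsum (ht j hj)
  rcases r with _ | r
  · have h := adjacency_localVector_add (x := x) (v := v) hΓ hbip 1 0
    rw [h1, Matrix.mulVec_zero, Matrix.mulVec_zero, zero_add] at h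
    refine h.trans ?_
    rw [hs 0 le_rfl, omega_one_eq hΓ hbip hr (hp 1 (by omega)) (hp 2 (by omega))]
    push_cast
    module
  -- The relation contains E*_{r+2} A_{r+2} v and E*_{r+3} A_{r+3} v, which the zero-sum rule turns
  -- into (α_r - 1) u_r and (α_{r+1} - 1) u_{r+1}. Raising the former leaves only multiples of
  -- u_{r+1}.
  · have h := adjacency_localVector_add (x := x) (v := v) hΓ hbip (r + 2) (r + 1)
    rw [hs r (by omega), Matrix.mulVec_smul, Matrix.mulVec_smul,
      raise_localVector hΓ hbip (by omega) hv, hs (r + 1) le_rfl] at h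
    refine (eq_sub_of_add_eq' h).trans ?_
    rw [omega_succ_succ_eq hΓ hbip (by omega) (hp (r + 2) (by omega)) (hp (r + 3) (by omega))]
    push_cast
    module

theorem adjacency_mulVec_localVector_zero (hΓ : IsDistanceRegular Γ) (hbip : Γ.IsBipartite)
    (hD : 1 ≤ Γ.diam) (hv : ∀ w, v w ≠ 0 → Γ.dist x w = 2) (h1 : localVector Γ x v 1 1 = 0) :
    adjacency Γ *ᵥ localVector Γ x v 2 0 = (c Γ 1 : ℂ) • localVector Γ x v 3 1 := by
  rw [adjacency_mulVec_eq_add hΓ.connected hbip dist_eq_of_localVector_ne_zero,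
    raise_localVector hΓ hbip hD hv 0, localVector_two_zero hΓ.connected hv, ← localVector_eq, h1,
    add_zero]

theorem adjacency_mulVec_localVector_succ (hΓ : IsDistanceRegular Γ) (hbip : Γ.IsBipartite)
    (hD : 1 ≤ Γ.diam) (hv : ∀ w, v w ≠ 0 → Γ.dist x w = 2) {r : ℕ} {a : ℂ}
    (h : dualIdempotent Γ x (r + 2) *ᵥ (adjacency Γ *ᵥ localVector Γ x v (r + 3) (r + 1)) =
      a • localVector Γ x v (r + 2) r) :
    adjacency Γ *ᵥ localVector Γ x v (r + 3) (r + 1) =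
      (c Γ (r + 2) : ℂ) • localVector Γ x v (r + 4) (r + 2) + a • localVector Γ x v (r + 2) r := by
  rw [adjacency_mulVec_eq_add hΓ.connected hbip dist_eq_of_localVector_ne_zero, h,
    raise_localVector hΓ hbip hD hv (r + 1)]

/-- If the vectors `E*_{r+2} A_r v` with `r ≤ m` span a `T`-stable space, this is `W`. -/
theorem span_localVector_eq (hΓ : IsDistanceRegular Γ) (hbip : Γ.IsBipartite)
    (hD : 1 ≤ Γ.diam) (hW : IsIrreducibleTModule Γ x W) (hv : v ∈ dualComponent Γ x W 2)
    (hv0 : v ≠ 0) (h1 : localVector Γ x v 1 1 = 0) {m : ℕ} {a : ℕ → ℂ}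
    (hlow : ∀ r < m,
      dualIdempotent Γ x (r + 2) *ᵥ (adjacency Γ *ᵥ localVector Γ x v (r + 3) (r + 1)) =
        a r • localVector Γ x v (r + 2) r)
    (hm : localVector Γ x v (m + 3) (m + 1) = 0) :
    Submodule.span ℂ (Set.range fun i : Fin (m + 1) => localVector Γ x v (i + 2) i) = W := by
  have hsupp := dist_eq_of_mem_dualComponent hv
  set S := Submodule.span ℂ (Set.range fun i : Fin (m + 1) => localVector Γ x v (i + 2) i)
  have hmem : ∀ r ≤ m + 1, localVector Γ x v (r + 2) r ∈ S := by
    intro r hr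
    rcases hr.eq_or_lt with rfl | hr
    · rw [hm]
      exact S.zero_mem
    · exact Submodule.subset_span ⟨⟨r, hr⟩, rfl⟩
  have hle : S ≤ W := by
    refine Submodule.span_le.2 ?_
    rintro _ ⟨i, rfl⟩
    exact mem_of_mem_dualComponent hW.isTModule (localVector_mem_dualComponent hΓ hbip hD
      hW.isTModule (mem_of_mem_dualComponent hW.isTModule hv) _ _)
  -- Stability under A is closed at the bottom by `h1` and at the top by `hm`.
  have hT : IsTModule Γ x S := by
    refine isTModule_of_stable (fun w hw => ?_) fun i w hw => ?_
    · refine Submodule.span_induction ?_ ?_ ?_ ?_ hw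
      · rintro _ ⟨⟨r, hr⟩, rfl⟩
        rcases r with _ | r
        · change adjacency Γ *ᵥ localVector Γ x v 2 0 ∈ S
          rw [adjacency_mulVec_localVector_zero hΓ hbip hD hsupp h1]
          exact S.smul_mem _ (hmem 1 (by omega))
        · change adjacency Γ *ᵥ localVector Γ x v (r + 3) (r + 1) ∈ S
          rw [adjacency_mulVec_localVector_succ hΓ hbip hD hsupp (hlow r (by omega))]
          exact S.add_mem (S.smul_mem _ (hmem (r + 2) (by omega)))
            (S.smul_mem _ (hmem r (by omega)))
      · rw [Matrix.mulVec_zero]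
        exact S.zero_mem
      · intro a b _ _ ha hb
        rw [Matrix.mulVec_add]
        exact S.add_mem ha hb
      · intro a b _ hb
        rw [Matrix.mulVec_smul]
        exact S.smul_mem _ hb
    · refine Submodule.span_induction ?_ ?_ ?_ ?_ hw
      · rintro _ ⟨⟨r, hr⟩, rfl⟩
        change dualIdempotent Γ x i *ᵥ localVector Γ x v (r + 2) r ∈ S
        rcases eq_or_ne i (r + 2) with rfl | hne
        · rw [dualIdempotent_mulVec_self dist_eq_of_localVector_ne_zero]
          exact hmem r (by omega)
        · rw [dualIdempotent_mulVec_eq_zero hne dist_eq_of_localVector_ne_zero]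
          exact S.zero_mem
      · rw [Matrix.mulVec_zero]
        exact S.zero_mem
      · intro a b _ _ ha hb
        rw [Matrix.mulVec_add]
        exact S.add_mem ha hb
      · intro a b _ hb
        rw [Matrix.mulVec_smul]
        exact S.smul_mem _ hb
  refine (hW.eq_bot_or_eq S hle hT).resolve_left fun hbot => hv0 ?_
  have h0 := hmem 0 (by omega)
  rwa [hbot, Submodule.mem_bot, localVector_two_zero hΓ.connected hsupp] at h0

/-- A vector of the span of the `E*_{r+2} A_r v` with `r ≤ m` that is supported at distance `m + 3`
or more from `x` is zero. -/
theorem eq_zero_of_mem_span_localVector {m i : ℕ} (hi : m + 2 < i) {u : X → ℂ}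
    (hu : ∀ y, u y ≠ 0 → Γ.dist x y = i)
    (hmem : u ∈ Submodule.span ℂ
      (Set.range fun i : Fin (m + 1) => localVector Γ x v (i + 2) i)) : u = 0 := by
  have : Submodule.span ℂ (Set.range fun i : Fin (m + 1) => localVector Γ x v (i + 2) i) ≤
      LinearMap.ker (dualIdempotent Γ x i).mulVecLin := by
    refine Submodule.span_le.2 ?_
    rintro _ ⟨⟨r, hr⟩, rfl⟩
    exact dualIdempotent_mulVec_eq_zero (i := r + 2) (by omega) dist_eq_of_localVector_ne_zero
  have h := this hmem
  rwa [LinearMap.mem_ker, Matrix.mulVecLin_apply, dualIdempotent_mulVec_self hu] at h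

theorem exists_smul_eq_of_isThin (hthin : IsThin Γ x W) {i : ℕ} (hi : i ≤ Γ.diam) {u u' : X → ℂ}
    (hu : u ∈ dualComponent Γ x W i) (hu0 : u ≠ 0) (hu' : u' ∈ dualComponent Γ x W i) :
    ∃ a : ℂ, u' = a • u := by
  have h0 : (⟨u, hu⟩ : dualComponent Γ x W i) ≠ 0 := fun h => hu0 (congrArg Subtype.val h)
  obtain ⟨a, ha⟩ := (finrank_le_one_iff.1 (hthin i hi)).elim fun w hw => by
    obtain ⟨a, ha⟩ := hw ⟨u, hu⟩
    obtain ⟨a', ha'⟩ := hw ⟨u', hu'⟩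
    have ha0 : a ≠ 0 := by
      rintro rfl
      exact h0 (by rw [← ha, zero_smul])
    exact (⟨a' * a⁻¹, by rw [← ha, ← ha', smul_smul, inv_mul_cancel_right₀ ha0]⟩ :
      ∃ b : ℂ, (⟨u', hu'⟩ : dualComponent Γ x W i) = b • ⟨u, hu⟩)
  exact ⟨a, congrArg Subtype.val ha⟩

/-- The structure of `W` up to `E*_{r+2} W`, by induction on `r`. -/
theorem localVector_ne_zero_and (hΓ : IsDistanceRegular Γ) (hbip : Γ.IsBipartite)
    (hD : 4 ≤ Γ.diam) (hW : IsIrreducibleTModule Γ x W) (hthin : IsThin Γ x W)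
    (hv : v ∈ dualComponent Γ x W 2) (hv0 : v ≠ 0) (hsum : ∑ w, v w = 0)
    (h1 : localVector Γ x v 1 1 = 0) (ht0 : t ≠ 0) (ht2 : t ^ 2 ≠ b Γ 2)
    (hη : localVector Γ x v 2 2 = (tilde Γ t : ℂ) • v) :
    ∀ r, r + 4 ≤ Γ.diam →
      (∀ j ≤ r, localVector Γ x v (j + 2) j ≠ 0 ∧ localVector Γ x v (j + 2) (j + 4) =
        -(localRatio Γ t j : ℂ) • localVector Γ x v (j + 2) j) ∧
      ∀ j ≤ r + 2, (p Γ j).eval t ≠ 0 := by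
  have hsupp := dist_eq_of_mem_dualComponent hv
  intro r
  induction r with
  | zero =>
    intro _
    refine ⟨fun j hj => ?_, fun j hj => ?_⟩
    · obtain rfl := Nat.le_zero.1 hj
      have h := localVector_add_add hΓ.connected hbip hsupp hsum 0
      simp only [zero_add] at h ⊢
      rw [localVector_two_zero hΓ.connected hsupp, hη] at h
      rw [localVector_two_zero hΓ.connected hsupp, ← localRatio_zero hΓ hbip (by omega) ht2]
      refine ⟨hv0, ?_⟩
      rw [← sub_eq_zero, ← h]
      push_cast
      module
    · interval_cases j
      · rw [p_zero, Polynomial.eval_one]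
        exact one_ne_zero
      · rwa [eval_p_one hΓ (by omega)]
      · exact eval_p_two_ne_zero hΓ hbip (by omega) ht2
  | succ r ih =>
    intro hr
    obtain ⟨hu, hp⟩ := ih (by omega)
    have hlow : ∀ j ≤ r,
        dualIdempotent Γ x (j + 2) *ᵥ (adjacency Γ *ᵥ localVector Γ x v (j + 3) (j + 1)) =
          (omega Γ t (j + 1) : ℂ) • localVector Γ x v (j + 2) j := fun j hj =>
      lower_localVector_eq_omega_smul hΓ hbip hsupp hsum h1 (by omega)
        (fun i hi => (hu i (by omega)).2) fun i hi => hp i (by omega)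
    have hmemW := mem_of_mem_dualComponent hW.isTModule hv
    have hT := localVector_mem_dualComponent hΓ hbip (by omega) hW.isTModule hmemW
      (r + 3) (r + 5)
    have hα := localRatio_ne_zero hΓ (t := t) (r := r) (by omega) (hp r (by omega))
      (hp (r + 2) le_rfl)
    have hlt := lower_localVector hΓ hbip hsupp r
    rw [(hu r le_rfl).2, smul_smul] at hlt
    have hbα : (b Γ (r + 4) : ℂ) * -(localRatio Γ t r : ℂ) ≠ 0 :=
      mul_ne_zero (Nat.cast_ne_zero.2 (hΓ.b_pos (by omega)).ne')
        (neg_ne_zero.2 (Complex.ofReal_ne_zero.2 hα))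
    -- Were u_{r+1} zero, W would be spanned by u_0, …, u_r and E*_{r+3} A_{r+5} v would vanish,
    -- although lowering it gives a nonzero multiple of u_r.
    have hne : localVector Γ x v (r + 3) (r + 1) ≠ 0 := by
      intro h0
      have hspan := span_localVector_eq hΓ hbip (by omega) hW hv hv0 h1 (m := r)
        (fun j hj => hlow j hj.le) h0
      have hz := eq_zero_of_mem_span_localVector (x := x) (v := v) (m := r) (i := r + 3)
        (by omega) dist_eq_of_localVector_ne_zero
        (hspan.symm ▸ mem_of_mem_dualComponent hW.isTModule hT)
      rw [hz, Matrix.mulVec_zero, Matrix.mulVec_zero] at hlt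
      exact (smul_ne_zero hbα (hu r le_rfl).1) hlt.symm
    obtain ⟨a, ha⟩ := exists_smul_eq_of_isThin hthin (by omega)
      (localVector_mem_dualComponent hΓ hbip (by omega) hW.isTModule hmemW (r + 3) (r + 1)) hne hT
    rw [ha, Matrix.mulVec_smul, Matrix.mulVec_smul, hlow r le_rfl, smul_smul] at hlt
    -- Two computations of the same lowered vector: a ω_{r+1} = -b_{r+4} α_r, which is nonzero.
    have hscal := smul_left_injective ℂ (hu r le_rfl).1 hlt
    have hω : omega Γ t (r + 1) ≠ 0 := by
      intro h0
      rw [h0, Complex.ofReal_zero] at hscal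
      exact hbα (hscal.symm.trans (mul_zero a))
    have hp3 := eval_p_ne_zero_of_omega_ne_zero hω
    have hstep := localRatio_succ_mul_omega hΓ (by omega) (hp r (by omega)) (hp (r + 1) (by omega))
      (hp (r + 2) le_rfl) hp3
    have haα : a = -(localRatio Γ t (r + 1) : ℂ) := by
      refine mul_right_cancel₀ (Complex.ofReal_ne_zero.2 hω) (hscal.trans ?_)
      rw [neg_mul, ← Complex.ofReal_mul, hstep]
      push_cast
      ring
    refine ⟨fun j hj => ?_, fun j hj => ?_⟩
    · rcases hj.eq_or_lt with rfl | hj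
      · exact ⟨hne, haα ▸ ha⟩
      · exact hu j (by omega)
    · rcases hj.eq_or_lt with rfl | hj
      · exact hp3
      · exact hp j (by omega)

/-- The vectors lie on distinct spheres around x, so a dual idempotent isolates each coefficient. -/
theorem linearIndependent_localVector {N : ℕ}
    (h : ∀ i : Fin N, localVector Γ x v (i + 2) i ≠ 0) :
    LinearIndependent ℂ fun i : Fin N => localVector Γ x v (i + 2) i := by
  rw [Fintype.linearIndependent_iff]
  intro g hg i
  have h' := congrArg (fun u => dualIdempotent Γ x (i + 2) *ᵥ u) hg
  simp only [Matrix.mulVec_sum, Matrix.mulVec_smul, Matrix.mulVec_zero] at h'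
  rw [Finset.sum_eq_single i, dualIdempotent_mulVec_self dist_eq_of_localVector_ne_zero] at h'
  · exact (smul_eq_zero.1 h').resolve_right (h i)
  · intro j _ hj
    rw [dualIdempotent_mulVec_eq_zero (i := j + 2) _ dist_eq_of_localVector_ne_zero, smul_zero]
    intro h
    exact hj (Fin.ext (by omega))
  · exact fun h => (h (Finset.mem_univ i)).elim

/-- `A` acts on the vectors `E*_{r+2} A_r v` by the tridiagonal matrix. -/
theorem sum_tridiagonal_smul_localVector (hΓ : IsDistanceRegular Γ) (hbip : Γ.IsBipartite)
    (hD : 4 ≤ Γ.diam) (hv : ∀ w, v w ≠ 0 → Γ.dist x w = 2) (h1 : localVector Γ x v 1 1 = 0)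
    (hlow : ∀ r, r + 4 < Γ.diam →
      dualIdempotent Γ x (r + 2) *ᵥ (adjacency Γ *ᵥ localVector Γ x v (r + 3) (r + 1)) =
        (omega Γ t (r + 1) : ℂ) • localVector Γ x v (r + 2) r)
    (hlast : localVector Γ x v (Γ.diam - 3 + 2) (Γ.diam - 3) = 0) (s : Fin (Γ.diam - 3)) :
    ∑ r, tridiagonal Γ t r s • localVector Γ x v (r + 2) r =
      adjacency Γ *ᵥ localVector Γ x v (s + 2) s := by
  have hsplit : ∀ r : Fin (Γ.diam - 3), tridiagonal Γ t r s • localVector Γ x v (r + 2) r =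
      (if (r : ℕ) = s + 1 then (c Γ (s + 1) : ℂ) • localVector Γ x v (s + 3) (s + 1) else 0) +
      if (s : ℕ) = r + 1 then (omega Γ t s : ℂ) • localVector Γ x v (r + 2) r else 0 := by
    intro r
    rw [tridiagonal, Matrix.of_apply]
    by_cases h : (r : ℕ) = s + 1
    · rw [if_pos h, if_pos h, if_neg (by omega), h, add_zero]
    · by_cases h' : (s : ℕ) = r + 1
      · rw [if_neg h, if_neg h, if_pos h', if_pos h', zero_add]
      · rw [if_neg h, if_neg h, if_neg h', if_neg h', zero_add, zero_smul]
  have hfirst : ∑ r : Fin (Γ.diam - 3), (if (r : ℕ) = s + 1 then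
      (c Γ (s + 1) : ℂ) • localVector Γ x v (s + 3) (s + 1) else 0) =
      (c Γ (s + 1) : ℂ) • localVector Γ x v (s + 3) (s + 1) := by
    rcases Nat.lt_or_ge ((s : ℕ) + 1) (Γ.diam - 3) with h | h
    · rw [Finset.sum_eq_single ⟨(s : ℕ) + 1, h⟩, if_pos rfl]
      · exact fun r _ hr => if_neg fun h' => hr (Fin.ext h')
      · exact fun h' => (h' (Finset.mem_univ _)).elim
    -- In the last column the raised vector is u_{D-3} = 0, matching the absence of a further row.
    · have hs : (s : ℕ) + 1 = Γ.diam - 3 := by omega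
      have hz : localVector Γ x v (s + 3) (s + 1) = 0 := by
        rw [show (s : ℕ) + 3 = Γ.diam - 3 + 2 by omega, hs]
        exact hlast
      simp [hz]
  rw [Finset.sum_congr rfl fun r _ => hsplit r, Finset.sum_add_distrib, hfirst]
  obtain ⟨s, hs⟩ := s
  rcases s with _ | s
  · rw [Finset.sum_eq_zero fun r _ => if_neg (by simp), add_zero]
    exact (adjacency_mulVec_localVector_zero hΓ hbip (by omega) hv h1).symm
  · rw [Finset.sum_eq_single ⟨s, by omega⟩, if_pos rfl]
    · exact (adjacency_mulVec_localVector_succ hΓ hbip (by omega) hv (hlow s (by omega))).symm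
    · exact fun r _ hr => if_neg fun h' => hr (Fin.ext (by simpa using h'.symm))
    · exact fun h' => (h' (Finset.mem_univ _)).elim

end ThinModules

end DRG

/-! ### The main theorem. -/

theorem mainTheorem9 {X : Type*} [Fintype X] [DecidableEq X] (Γ : SimpleGraph X)
    (hΓ : DRG.IsDistanceRegular Γ) (hbip : Γ.IsBipartite)
    (hD : 4 ≤ Γ.diam) (hk : 3 ≤ DRG.b Γ 0) (x : X)
    (n : ℕ) (hn : n = 1 ∨ (Odd Γ.diam ∧ n = Γ.diam / 2))
    (W : Submodule ℂ (X → ℂ)) (hW : DRG.IsIrreducibleTModule Γ x W)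
    (hthin : DRG.IsThin Γ x W) (hend : DRG.endpoint Γ x W = 2)
    (hη : DRG.HasLocalEigenvalue Γ x W (DRG.tilde Γ (DRG.eigenvalue Γ n)))
    (v : X → ℂ) (hv : v ∈ DRG.dualComponent Γ x W 2) (hv0 : v ≠ 0) :
    (∀ i : ℕ, 1 ≤ i → i ≤ Γ.diam - 4 →
      DRG.c Γ i ≠ 0 ∧ (DRG.p Γ i).eval (DRG.eigenvalue Γ n) ≠ 0 ∧
        (DRG.p Γ (i + 1)).eval (DRG.eigenvalue Γ n) ≠ 0) ∧
    ∃ B : Module.Basis (Fin (Γ.diam - 3)) ℂ W,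
      (∀ i : Fin (Γ.diam - 3), (B i : X → ℂ) =
        (DRG.dualIdempotent Γ x ((i : ℕ) + 2) * DRG.distanceMatrix Γ i) *ᵥ v) ∧
      LinearMap.toMatrix B B (DRG.adjacencyOn Γ x W hW.isTModule) =
        DRG.tridiagonal Γ (DRG.eigenvalue Γ n) := by
  open DRG in
  obtain ⟨hpos, -, hb2⟩ := eigenvalue_properties hΓ hbip hD hn
  have hroot := eval_p_eigenvalue_eq_zero hΓ hbip hD hn
  set t := eigenvalue Γ n
  have hsupp := dist_eq_of_mem_dualComponent hv
  have hvW := mem_of_mem_dualComponent hW.isTModule hv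
  have hsum := sum_eq_zero_of_dualComponent_zero_eq_bot hΓ hbip (by omega) hW.isTModule
    (dualComponent_eq_bot_of_lt_endpoint (by omega) (by omega)) hv
  have h1 : localVector Γ x v 1 1 = 0 := by
    have h := localVector_mem_dualComponent hΓ hbip (by omega) hW.isTModule hvW 1 1
    rwa [dualComponent_eq_bot_of_lt_endpoint (by omega) (by omega), Submodule.mem_bot] at h
  have h22 : localVector Γ x v 2 2 = (tilde Γ t : ℂ) • v := by
    rw [← hη.2 v hv, ← Matrix.mulVec_mulVec, dualIdempotent_mulVec_self hsupp, localVector]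
  -- With m = D - 4 the induction reaches the last basis vector u_m and the nonvanishing of p_j(θ_n)
  -- for j ≤ D - 2.
  obtain ⟨m, hm⟩ := Nat.exists_eq_add_of_le' hD
  obtain ⟨hu, hp⟩ := localVector_ne_zero_and hΓ hbip hD hW hthin hv hv0 hsum h1 hpos.ne' hb2 h22
    m hm.ge
  have hlow : ∀ r, r + 4 ≤ Γ.diam →
      dualIdempotent Γ x (r + 2) *ᵥ (adjacency Γ *ᵥ localVector Γ x v (r + 3) (r + 1)) =
        (omega Γ t (r + 1) : ℂ) • localVector Γ x v (r + 2) r := fun r hr =>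
    lower_localVector_eq_omega_smul hΓ hbip hsupp hsum h1 (by omega)
      (fun j hj => (hu j (by omega)).2) fun j hj => hp j (by omega)
  -- The factor p_{D-1}(θ_n) = 0 makes ω_{D-3} zero, so lowering annihilates u_{D-3}, and
  -- adjointness gives u_{D-3} = 0.
  have hlast : localVector Γ x v (m + 3) (m + 1) = 0 := by
    refine localVector_eq_zero_of_lower_eq_zero hΓ hbip hsupp (by omega) ?_
    rw [hlow m hm.ge, omega_eq_zero, Complex.ofReal_zero, zero_smul]
    rwa [show m + 3 = Γ.diam - 1 by omega]
  have hspan := span_localVector_eq hΓ hbip (by omega) hW hv hv0 h1 (m := m)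
    (fun r hr => hlow r (by omega)) hlast
  rw [show m + 1 = Γ.diam - 3 by omega] at hspan
  have hli := linearIndependent_localVector (Γ := Γ) (x := x) (v := v) (N := Γ.diam - 3)
    fun i => (hu i (by omega)).1
  let B : Module.Basis (Fin (Γ.diam - 3)) ℂ W :=
    (Module.Basis.span hli).map (LinearEquiv.ofEq _ _ hspan)
  have hB : ∀ i, (B i : X → ℂ) = localVector Γ x v (i + 2) i := fun i => by
    simp [B, Module.Basis.span_apply]
  refine ⟨fun i hi hi' => ⟨?_, hp i (by omega), hp (i + 1) (by omega)⟩, B, hB, ?_⟩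
  · obtain ⟨j, rfl⟩ := Nat.exists_eq_add_of_le' hi
    exact (hΓ.c_pos (by omega)).ne'
  · refine (LinearEquiv.eq_symm_apply (LinearMap.toMatrix B B)).1 (B.ext fun s => ?_)
    rw [LinearMap.toMatrix_symm, Matrix.toLin_self]
    refine Subtype.ext ?_
    have hlast' : localVector Γ x v (Γ.diam - 3 + 2) (Γ.diam - 3) = 0 := by
      rwa [show Γ.diam - 3 = m + 1 by omega]
    have h := sum_tridiagonal_smul_localVector hΓ hbip hD hsupp h1
      (fun r hr => hlow r (by omega)) hlast' s
    rw [Submodule.coe_sum]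
    simp only [Submodule.coe_smul, hB]
    rw [h, ← hB]
    rfl
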